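/- Let $n\ge 0$ be an integer, $\alpha\ge 0$, $0<\zeta_1<\cdots<\zeta_n$ and $b_j(t)=b_j(0)e^{\zeta_j t}$ with $b_j(0)>0$ $(1\le j\le n)$. Put $f_i(t)=\sum_{j=1}^n\zeta_j^{\,i}\,b_j(t)$ for $i\in\mathbb Z$ and define skew-symmetric Pfaffian entries by $$(d_0,i)=f_i(t),\qquad (i,j)=e^{-\alpha t}\iint_{-\infty<t_1<t_2<t}e^{\alpha t_2}\bigl[f_{i+1}(t_1)f_{j+1}(t_2)-f_{i+1}(t_2)f_{j+1}(t_1)\bigr]\,dt_1\,dt_2 .$$ Write $(a_1,\dots,a_{2N})$ for the Pfaffian of the skew-symmetric matrix with entries $(a_p,a_q)$; the Pfaffian of order $0$ is $1$. Define functions of $t$ by $$\tilde\tau_{2k}=(0,1,\dots,2k-1),\quad \tilde\tau_{2k-1}=(d_0,0,1,\dots,2k-2),\quad \tilde\sigma_{2k}=(1,2,\dots,2k),\quad \tilde\sigma_{2k-1}=(d_0,1,2,\dots,2k-1)$$ for nonnegative indices, and $\tilde\tau_k=\tilde\sigma_k=0$ for $k<0$. Then $\tilde\tau_k(t)\neq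 0$ for $0\le k\le n$ and all $t\in\mathbb R$, and the functions $$\tilde r_k=\frac{\tilde\tau_k}{\tilde\tau_{k-1}},\qquad \tilde s_k=\frac{\tilde\sigma_{k-1}}{\tilde\tau_k}$$ ($\tilde r_k$ for $1\le k\le n+1$, $\tilde s_k$ for $0\le k\le n$) solve, for all $t\in\mathbb R$, the generalized finite modified B-Toda lattice $$\dot{\tilde r}_k=\frac{\tilde r_k\,(\dot{\tilde s}_{k-1}+\dot{\tilde s}_k-\alpha\tilde s_{k-1})}{\tilde s_{k-1}-\tilde s_k},\qquad \dot{\tilde s}_k=\frac{\tilde r_{k+1}}{\tilde r_k}\,(\tilde s_{k-1}-\tilde s_{k+1}),\qquad k=1,\dots,n,$$ with boundary conditions $\tilde s_0=\tilde r_{n+1}=0$ and $\tilde r_{n+1}\tilde s_{n+1}\neq0$. Here $\tilde s_{n+1}$ itself is infinite, and $\tilde r_{n+1}\tilde s_{n+1}$ stands for the formal product $\tilde\sigma_n/\tilde\tau_n$ (the common factor $\tilde\tau_{n+1}=0$ being cancelled), so that the second equation for $k=n$ reads $\dot{\tilde s}_n=(\tilde r_{n+1}\tilde s_{n-1}-\tilde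 r_{n+1}\tilde s_{n+1})/\tilde r_n$. That these functions solve the lattice includes that $\tilde r_1,\dots,\tilde r_n$ and $\tilde s_0,\dots,\tilde s_n$ are differentiable and that the denominators $\tilde r_k$ and $\tilde s_{k-1}-\tilde s_k$ $(1\le k\le n)$ never vanish. -/

import Mathlib

open scoped Nat

noncomputable section

namespace GenBToda

/-- The Pfaffian of a (skew-symmetric) real `2N × 2N` matrix:
`(1 / (2^N N!)) ∑_π sgn(π) ∏_l A_{π(2l), π(2l+1)}`, the sum being over all permutations.
For skew-symmetric `A` every perfect matching is counted `2^N N!` times with the same sign, so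
this is the signed sum over perfect matchings. The Pfaffian of order `0` is `1`. -/
def pfaffian {N : ℕ} (A : Matrix (Fin (2 * N)) (Fin (2 * N)) ℝ) : ℝ :=
  (1 / ((2 : ℝ) ^ N * (N ! : ℝ))) *
    ∑ π : Equiv.Perm (Fin (2 * N)), ((Equiv.Perm.sign π : ℤ) : ℝ) *
      ∏ l : Fin N, A (π ⟨2 * l.1, by omega⟩) (π ⟨2 * l.1 + 1, by omega⟩)

/-- `f_i(t) = ∑_j ζ_j^i b_j(t)` with `b_j(t) = β_j exp(ζ_j t)`, so that `β_j = b_j(0)`. -/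
def f {n : ℕ} (ζ β : Fin n → ℝ) (i : ℤ) (t : ℝ) : ℝ :=
  ∑ j : Fin n, ζ j ^ i * (β j * Real.exp (ζ j * t))

/-- The symbols occurring in the Pfaffians: the character `d₀` and the integers. -/
inductive Symb
  | d0 : Symb
  | num : ℤ → Symb

/-- The Pfaffian entry `(i, j) =
e^{-α t} ∬_{-∞ < t₁ < t₂ < t} e^{α t₂} [f_{i+1}(t₁) f_{j+1}(t₂) - f_{i+1}(t₂) f_{j+1}(t₁)]`. -/
def entryInt {n : ℕ} (α : ℝ) (ζ β : Fin n → ℝ) (t : ℝ) (i j : ℤ) : ℝ :=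
  Real.exp (-α * t) *
    ∫ t₂ in Set.Iio t, ∫ t₁ in Set.Iio t₂,
      Real.exp (α * t₂) *
        (f ζ β (i + 1) t₁ * f ζ β (j + 1) t₂ - f ζ β (i + 1) t₂ * f ζ β (j + 1) t₁)

/-- All Pfaffian entries at time `t`, with `(d₀, i) = f_i(t)`, extended skew-symmetrically. -/
def entry {n : ℕ} (α : ℝ) (ζ β : Fin n → ℝ) (t : ℝ) : Symb → Symb → ℝ
  | .d0, .d0 => 0
  | .d0, .num i => f ζ β i t
  | .num i, .d0 => -f ζ β i t
  | .num i, .num j => entryInt α ζ β t i j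

/-- The word `l, l + 1, l + 2, …`. -/
def evenWord (l : ℤ) (a : ℕ) : Symb := .num (l + a)

/-- The word `d₀, l, l + 1, l + 2, …`. -/
def oddWord (l : ℤ) : ℕ → Symb
  | 0 => .d0
  | a + 1 => .num (l + a)

/-- The Pfaffian formed by the first `2N` symbols of the word `w`. -/
def pfWord {n : ℕ} (α : ℝ) (ζ β : Fin n → ℝ) (t : ℝ) (N : ℕ) (w : ℕ → Symb) : ℝ :=
  pfaffian (N := N) fun a b => entry α ζ β t (w a.1) (w b.1)

/-- For `k ∈ ℤ`: the Pfaffian `(l, …, l + k - 1)` for even `k ≥ 0`, the Pfaffian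
`(d₀, l, …, l + k - 1)` for odd `k ≥ 1`, and `0` for `k < 0`. -/
def pfSeq {n : ℕ} (α : ℝ) (ζ β : Fin n → ℝ) (l : ℤ) (k : ℤ) (t : ℝ) : ℝ :=
  match k with
  | Int.ofNat m =>
      if Even m then pfWord α ζ β t (m / 2) (evenWord l)
      else pfWord α ζ β t ((m + 1) / 2) (oddWord l)
  | Int.negSucc _ => 0

/-- `τ̃_{2k} = (0, …, 2k-1)`, `τ̃_{2k-1} = (d₀, 0, …, 2k-2)`. -/
def tau {n : ℕ} (α : ℝ) (ζ β : Fin n → ℝ) (k : ℤ) (t : ℝ) : ℝ := pfSeq α ζ β 0 k t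

/-- `σ̃_{2k} = (1, …, 2k)`, `σ̃_{2k-1} = (d₀, 1, …, 2k-1)`. -/
def sigma {n : ℕ} (α : ℝ) (ζ β : Fin n → ℝ) (k : ℤ) (t : ℝ) : ℝ := pfSeq α ζ β 1 k t

/-- `(r, s)` is a solution, for all `t ∈ ℝ`, of the generalized finite modified B-Toda lattice
`r_k' = r_k (s_{k-1}' + s_k' - α s_{k-1}) / (s_{k-1} - s_k)`,
`s_k' = (r_{k+1} / r_k) (s_{k-1} - s_{k+1})`, `k = 1, …, n`,
with the boundary conditions `s_0 = r_{n+1} = 0` and `r_{n+1} s_{n+1} ≠ 0`.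

Since `r_{n+1} = 0`, the quantity `s_{n+1}` is infinite and only the product `r_{n+1} s_{n+1}` has
a meaning; the function `w` is that product. It enters the lattice only through the equation for
`s_n'`, which is therefore written with `r_{n+1} (s_{n-1} - s_{n+1})` expanded. -/
structure IsSolution (n : ℕ) (α : ℝ) (r s : ℤ → ℝ → ℝ) (w : ℝ → ℝ) : Prop where
  differentiable_r : ∀ k : ℤ, 1 ≤ k → k ≤ n → Differentiable ℝ (r k)
  differentiable_s : ∀ k : ℤ, 0 ≤ k → k ≤ n → Differentiable ℝ (s k)
  r_ne_zero : ∀ k : ℤ, 1 ≤ k → k ≤ n → ∀ t, r k t ≠ 0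
  s_sub_ne_zero : ∀ k : ℤ, 1 ≤ k → k ≤ n → ∀ t, s (k - 1) t - s k t ≠ 0
  deriv_r : ∀ k : ℤ, 1 ≤ k → k ≤ n → ∀ t,
    deriv (r k) t =
      r k t * (deriv (s (k - 1)) t + deriv (s k) t - α * s (k - 1) t) / (s (k - 1) t - s k t)
  deriv_s : ∀ k : ℤ, 1 ≤ k → k < n → ∀ t,
    deriv (s k) t = r (k + 1) t / r k t * (s (k - 1) t - s (k + 1) t)
  deriv_s_last : 1 ≤ n → ∀ t,
    deriv (s n) t = (r (n + 1) t * s (n - 1) t - w t) / r n t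
  s_zero : ∀ t, s 0 t = 0
  r_last : ∀ t, r (n + 1) t = 0
  w_ne_zero : ∀ t, w t ≠ 0

end GenBToda

end

/-!
The Pfaffians are linear functionals on an exterior algebra. For an alternating form `A` on `V`, the
operator `exp` of the contraction with `A`, followed by the projection to scalars, is a functional
`formPf A` on the exterior algebra of `V` whose value at `v₁ ∧ ⋯ ∧ v_{2N}` is the Pfaffian of the
matrix `A (v_a) (v_b)` (`pfaffian_eq_formPf`). Computing the integrals gives
`(i, j) = A (v_i) (v_j)`, where `v_i = (ζ_p ^ i b_p)_p` and `A` is the constant form with matrix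
`(ζ_q - ζ_p) / (α + ζ_p + ζ_q)` (`entryInt_eq_schurForm`). The character `d₀` acts as contraction by
the functional `v ↦ ∑ₚ v_p`. So every `τ` and `σ` is the value of one of two functionals at a product
of consecutive vectors `v_i` (`pfSeq_eq_charPf`).

*Bilinear equations.* The skew symmetry of `A` gives the identity `pairing_formPf`, and inserting
contractions into it gives the Pfaffian identities of Plücker type that are needed. Differentiation
in `t` is the derivation extending multiplication by `ζ`; on the words in question it shifts the
last index. It differs by a multiple of the degree from the derivation extending multiplication by
`ζ + α / 2`, which changes `A` only by a form of rank two, that is, by the insertion of two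
characters (`expContract_extDerivation`). The outcome is, for all `k ≥ 1`,
`σ_{k-1}' τ_k - σ_{k-1} τ_k' = σ_{k-2} τ_{k+1} - σ_k τ_{k-1}` and
`τ_k' σ_{k-2} - τ_k σ_{k-2}' + α σ_{k-2} τ_k = τ_{k-1} σ_{k-1}' - τ_{k-1}' σ_{k-1}`
(`prevSigma_hirota`, `prevSigma_toda`). Dividing by products of the `τ`, these are the two equations
of the lattice.

*Positivity.* The minor summation formula and Schur's Pfaffian, with `x_p = ζ_p + α / 2`, express
`τ_k` and `σ_k` as sums of positive terms over `k`-tuples of distinct nodes (`momentPf_eq_sum`).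
Hence they are positive for `k ≤ n` and vanish for `k = n + 1`.

*The denominators.* Up to a positive factor, `s_k - s_{k-1}` is
`W_{k-1} = τ_{k-1} σ_{k-1} - τ_k σ_{k-2}`. By the sum formula each `W_j` with `j < n` is positive
near `t = -∞`. At the first time where some `W_j` vanishes all of them are nonnegative, and then the
bilinear equations force `W_{j-1} = 0`, and so on down to `W_0 = 1`, a contradiction (`cross_pos`).
-/

noncomputable section

namespace GenBToda

open MeasureTheory Filter Topology

/-! ### The Pfaffian of an alternating form as a functional on the exterior algebra -/

open CliffordAlgebra (contractLeft changeForm)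

section FormPfaffian

variable {V : Type*} [AddCommGroup V] [Module ℝ V]

theorem toQuadraticMap_neg_eq_zero {A : LinearMap.BilinForm ℝ V} (hA : A.IsAlt) :
    (-A).toQuadraticMap = (0 : QuadraticForm ℝ V) - 0 := by
  ext v
  simp [hA v]

/-- The operator `exp` of the contraction with the alternating form `A` on the exterior algebra,
realised as the change of the (zero) quadratic form of a Clifford algebra by the bilinear form `-A`,
whose quadratic form is zero as well. -/
def expContract (A : LinearMap.BilinForm ℝ V) (hA : A.IsAlt) :
    ExteriorAlgebra ℝ V →ₗ[ℝ] ExteriorAlgebra ℝ V :=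
  changeForm (toQuadraticMap_neg_eq_zero hA)

/-- The Pfaffian of an alternating form: the functional whose value at `v₁ ∧ ⋯ ∧ v_{2N}` is the
Pfaffian of the matrix `A (v_a) (v_b)`, and whose value in odd degree is zero. -/
def formPf (A : LinearMap.BilinForm ℝ V) (hA : A.IsAlt) : ExteriorAlgebra ℝ V →ₗ[ℝ] ℝ :=
  (ExteriorAlgebra.algebraMapInv (R := ℝ) (M := V)).toLinearMap ∘ₗ expContract A hA

/-- Contraction of the exterior algebra by a linear functional. -/
def contract (d : Module.Dual ℝ V) : ExteriorAlgebra ℝ V →ₗ[ℝ] ExteriorAlgebra ℝ V :=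
  contractLeft d

theorem contract_add (d d' : Module.Dual ℝ V) (x : ExteriorAlgebra ℝ V) :
    contract (d + d') x = contract d x + contract d' x := by
  simp [contract]

theorem contract_smul (c : ℝ) (d : Module.Dual ℝ V) (x : ExteriorAlgebra ℝ V) :
    contract (c • d) x = c • contract d x := by
  simp [contract]

theorem contract_sum {κ : Type*} (s : Finset κ) (d : κ → Module.Dual ℝ V)
    (x : ExteriorAlgebra ℝ V) : contract (∑ p ∈ s, d p) x = ∑ p ∈ s, contract (d p) x := by
  simp [contract, LinearMap.sum_apply]

theorem contract_ι_mul (d : Module.Dual ℝ V) (a : V) (x : ExteriorAlgebra ℝ V) :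
    contract d (ExteriorAlgebra.ι ℝ a * x) = d a • x - ExteriorAlgebra.ι ℝ a * contract d x :=
  CliffordAlgebra.contractLeft_ι_mul (Q := (0 : QuadraticForm ℝ V)) (d := d) a x

theorem contract_one (d : Module.Dual ℝ V) : contract d (1 : ExteriorAlgebra ℝ V) = 0 :=
  CliffordAlgebra.contractLeft_one (Q := (0 : QuadraticForm ℝ V)) (d := d)

theorem contract_comm (d d' : Module.Dual ℝ V) (x : ExteriorAlgebra ℝ V) :
    contract d (contract d' x) = -contract d' (contract d x) :=
  CliffordAlgebra.contractLeft_comm (Q := (0 : QuadraticForm ℝ V)) (d := d) (d' := d') x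

theorem contract_self (d : Module.Dual ℝ V) (x : ExteriorAlgebra ℝ V) :
    contract d (contract d x) = 0 :=
  CliffordAlgebra.contractLeft_contractLeft (Q := (0 : QuadraticForm ℝ V)) (d := d) x

theorem expContract_one (A : LinearMap.BilinForm ℝ V) (hA : A.IsAlt) :
    expContract A hA 1 = 1 :=
  CliffordAlgebra.changeForm_one _

theorem expContract_ι_mul (A : LinearMap.BilinForm ℝ V) (hA : A.IsAlt) (a : V)
    (x : ExteriorAlgebra ℝ V) :
    expContract A hA (ExteriorAlgebra.ι ℝ a * x) =
      ExteriorAlgebra.ι ℝ a * expContract A hA x + contract (A a) (expContract A hA x) := by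
  have h := CliffordAlgebra.changeForm_ι_mul (toQuadraticMap_neg_eq_zero hA) a x
  refine h.trans ?_
  rw [LinearMap.neg_apply, map_neg, LinearMap.neg_apply, sub_neg_eq_add]
  rfl

theorem expContract_contract (A : LinearMap.BilinForm ℝ V) (hA : A.IsAlt) (d : Module.Dual ℝ V)
    (x : ExteriorAlgebra ℝ V) :
    expContract A hA (contract d x) = contract d (expContract A hA x) :=
  CliffordAlgebra.changeForm_contractLeft (toQuadraticMap_neg_eq_zero hA) d x

theorem algebraMapInv_ι_mul (a : V) (x : ExteriorAlgebra ℝ V) :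
    ExteriorAlgebra.algebraMapInv (ExteriorAlgebra.ι ℝ a * x) = 0 := by
  simp [ExteriorAlgebra.algebraMapInv]

variable (A : LinearMap.BilinForm ℝ V) (hA : A.IsAlt)

theorem formPf_one : formPf A hA 1 = 1 := by
  simp [formPf, expContract_one]

/-- Expansion of the Pfaffian along the first row. -/
theorem formPf_ι_mul (a : V) (x : ExteriorAlgebra ℝ V) :
    formPf A hA (ExteriorAlgebra.ι ℝ a * x) = formPf A hA (contract (A a) x) := by
  simp only [formPf, LinearMap.comp_apply, expContract_ι_mul, map_add, expContract_contract,
    AlgHom.toLinearMap_apply, algebraMapInv_ι_mul, zero_add]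

theorem contract_ιMulti (d : Module.Dual ℝ V) (k : ℕ) (v : Fin (k + 1) → V) :
    contract d (ExteriorAlgebra.ιMulti ℝ (k + 1) v) =
      ∑ j : Fin (k + 1), ((-1 : ℝ) ^ (j : ℕ) * d (v j)) •
        ExteriorAlgebra.ιMulti ℝ k (v ∘ j.succAbove) := by
  induction k with
  | zero =>
    rw [ExteriorAlgebra.ιMulti_succ_apply, contract_ι_mul]
    simp [ExteriorAlgebra.ιMulti_zero_apply, contract_one]
  | succ k ih =>
    rw [ExteriorAlgebra.ιMulti_succ_apply, contract_ι_mul, ih, Fin.sum_univ_succ (n := k + 1)]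
    simp only [Fin.val_zero, pow_zero, one_mul, Finset.mul_sum, Fin.val_succ]
    rw [sub_eq_add_neg, ← Finset.sum_neg_distrib]
    congr 1
    refine Finset.sum_congr rfl fun j _ => ?_
    rw [ExteriorAlgebra.ιMulti_succ_apply (v := v ∘ j.succ.succAbove), mul_smul_comm, ← neg_smul]
    congr 1
    · simp [Matrix.vecTail, pow_succ]
    · congr 2
      funext i
      simp [Matrix.vecTail]

theorem formPf_ιMulti_succ (k : ℕ) (v : Fin (k + 2) → V) :
    formPf A hA (ExteriorAlgebra.ιMulti ℝ (k + 2) v) =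
      ∑ j : Fin (k + 1), (-1 : ℝ) ^ (j : ℕ) * A (v 0) (v j.succ) *
        formPf A hA (ExteriorAlgebra.ιMulti ℝ k (fun i => v (j.succAbove i).succ)) := by
  rw [ExteriorAlgebra.ιMulti_succ_apply, formPf_ι_mul, contract_ιMulti, map_sum]
  refine Finset.sum_congr rfl fun j _ => ?_
  rw [map_smul, smul_eq_mul]
  rfl

end FormPfaffian

/-! ### Derivations and bilinear identities -/

section Bilinear

variable {κ : Type*}

local notation "Λ" => ExteriorAlgebra ℝ (κ → ℝ)
local notation "ιᵥ" => ExteriorAlgebra.ι ℝ (M := κ → ℝ)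

/-- Contraction by the `p`-th coordinate functional. -/
def coordContract (p : κ) : Λ →ₗ[ℝ] Λ := contract (LinearMap.proj p)

theorem coordContract_ι_mul (p : κ) (a : κ → ℝ) (x : Λ) :
    coordContract p (ιᵥ a * x) = a p • x - ιᵥ a * coordContract p x :=
  contract_ι_mul _ _ _

theorem coordContract_one (p : κ) : coordContract p (1 : Λ) = 0 := contract_one _

theorem contract_coordContract (d : Module.Dual ℝ (κ → ℝ)) (p : κ) (x : Λ) :
    contract d (coordContract p x) = -coordContract p (contract d x) :=
  contract_comm _ _ _

/-- The product `F x * G y` of two linear functionals as a bilinear one. -/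
def prodForm (F G : Λ →ₗ[ℝ] ℝ) : Λ →ₗ[ℝ] Λ →ₗ[ℝ] ℝ := (LinearMap.mul ℝ ℝ).compl₁₂ F G

theorem prodForm_apply (F G : Λ →ₗ[ℝ] ℝ) (x y : Λ) : prodForm F G x y = F x * G y := rfl

variable [DecidableEq κ]

/-- Multiplication on the left by the `p`-th basis vector. -/
def basisMul (p : κ) : Λ →ₗ[ℝ] Λ := LinearMap.mulLeft ℝ (ιᵥ (Pi.single p 1))

theorem basisMul_apply (p : κ) (x : Λ) : basisMul p x = ιᵥ (Pi.single p 1) * x := rfl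

theorem contract_basisMul (d : Module.Dual ℝ (κ → ℝ)) (p : κ) (x : Λ) :
    contract d (basisMul p x) = d (Pi.single p 1) • x - basisMul p (contract d x) :=
  contract_ι_mul _ _ _

theorem ι_mul_basisMul (a : κ → ℝ) (p : κ) (x : Λ) :
    ιᵥ a * basisMul p x = -basisMul p (ιᵥ a * x) := by
  rw [basisMul_apply, basisMul_apply, ← mul_assoc, ← mul_assoc,
    eq_neg_of_add_eq_zero_left (ExteriorAlgebra.ι_add_mul_swap a (Pi.single p 1)), neg_mul]

variable [Fintype κ]

theorem map_eq_sum_single {W : Type*} [AddCommGroup W] [Module ℝ W] (g : (κ → ℝ) →ₗ[ℝ] W)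
    (a : κ → ℝ) : g a = ∑ p, a p • g (Pi.single p 1) := by
  conv_lhs => rw [pi_eq_sum_univ' a]
  simp [map_sum, Pi.single]

theorem ι_mul_eq_sum (a : κ → ℝ) (x : Λ) : ιᵥ a * x = ∑ p, a p • basisMul p x := by
  rw [map_eq_sum_single (ExteriorAlgebra.ι ℝ) a, Finset.sum_mul]
  simp [basisMul_apply]

theorem contract_eq_sum (d : Module.Dual ℝ (κ → ℝ)) (x : Λ) :
    contract d x = ∑ p, d (Pi.single p 1) • coordContract p x := by
  have : d = ∑ p, d (Pi.single p 1) • (LinearMap.proj p : Module.Dual ℝ (κ → ℝ)) := by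
    ext p
    simp [Pi.single_apply]
  conv_lhs => rw [this]
  rw [contract_sum]
  simp only [contract_smul, coordContract]

/-- The derivation of the exterior algebra extending the endomorphism `D`. -/
def extDerivation (D : (κ → ℝ) →ₗ[ℝ] (κ → ℝ)) : Λ →ₗ[ℝ] Λ :=
  ∑ p, LinearMap.mulLeft ℝ (ιᵥ (D (Pi.single p 1))) ∘ₗ coordContract p

theorem extDerivation_apply (D : (κ → ℝ) →ₗ[ℝ] (κ → ℝ)) (x : Λ) :
    extDerivation D x = ∑ p, ιᵥ (D (Pi.single p 1)) * coordContract p x := by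
  simp [extDerivation, LinearMap.sum_apply]

theorem extDerivation_one (D : (κ → ℝ) →ₗ[ℝ] (κ → ℝ)) : extDerivation D (1 : Λ) = 0 := by
  simp [extDerivation_apply, coordContract_one]

theorem extDerivation_ι_mul (D : (κ → ℝ) →ₗ[ℝ] (κ → ℝ)) (a : κ → ℝ) (x : Λ) :
    extDerivation D (ιᵥ a * x) = ιᵥ (D a) * x + ιᵥ a * extDerivation D x := by
  have hDa : ιᵥ (D a) = ∑ p, a p • ιᵥ (D (Pi.single p 1)) :=
    map_eq_sum_single (ExteriorAlgebra.ι ℝ ∘ₗ D) a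
  simp only [extDerivation_apply, coordContract_ι_mul, mul_sub, Finset.sum_sub_distrib,
    Finset.mul_sum, mul_smul_comm]
  rw [hDa, Finset.sum_mul, sub_eq_add_neg, ← Finset.sum_neg_distrib]
  congr 1
  · simp
  · refine Finset.sum_congr rfl fun p _ => ?_
    rw [← mul_assoc, ← mul_assoc,
      eq_neg_of_add_eq_zero_left (ExteriorAlgebra.ι_add_mul_swap a (D (Pi.single p 1))), neg_mul]

theorem contract_extDerivation (d : Module.Dual ℝ (κ → ℝ)) (D : (κ → ℝ) →ₗ[ℝ] (κ → ℝ)) (x : Λ) :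
    contract d (extDerivation D x) = contract (d ∘ₗ D) x + extDerivation D (contract d x) := by
  rw [contract_eq_sum (d ∘ₗ D) x]
  simp only [extDerivation_apply, map_sum, contract_ι_mul, contract_coordContract,
    mul_neg, sub_neg_eq_add, Finset.sum_add_distrib]
  rfl

section Derivative

variable (A : LinearMap.BilinForm ℝ (κ → ℝ)) (hA : A.IsAlt) (D : (κ → ℝ) →ₗ[ℝ] (κ → ℝ))
  (φ₀ φ₁ : Module.Dual ℝ (κ → ℝ))

/-- If the variation `A (D u) v + A u (D v)` of `A` along `D` is the form `φ₀ ∧ φ₁` of rank two, then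
`exp` of the contraction with `A` commutes with the derivation extending `D` up to the double
contraction by `φ₀` and `φ₁`. -/
theorem expContract_extDerivation
    (hD : ∀ u v, A (D u) v + A u (D v) = φ₀ u * φ₁ v - φ₁ u * φ₀ v) (x : Λ) :
    expContract A hA (extDerivation D x) =
      extDerivation D (expContract A hA x) - contract φ₀ (contract φ₁ (expContract A hA x)) := by
  induction x using CliffordAlgebra.left_induction with
  | algebraMap r =>
    have h : ((algebraMap ℝ (CliffordAlgebra (0 : QuadraticForm ℝ (κ → ℝ)))) r : Λ)
      = r • (1 : Λ) := Algebra.algebraMap_eq_smul_one r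
    rw [h]
    simp [extDerivation_one, expContract_one, contract_one]
  | add x y hx hy =>
    simp only [map_add]
    erw [hx, hy]
    abel
  | ι_mul x a ih =>
    change expContract A hA (extDerivation D (ιᵥ a * x)) =
      extDerivation D (expContract A hA (ιᵥ a * x)) -
        contract φ₀ (contract φ₁ (expContract A hA (ιᵥ a * x)))
    set y := expContract A hA x with hy
    have key : contract (A (D a)) y + contract (A a ∘ₗ D) y =
        φ₀ a • contract φ₁ y - φ₁ a • contract φ₀ y := by
      rw [← contract_add, ← contract_smul, ← contract_smul, sub_eq_add_neg,
        ← neg_one_smul ℝ (contract (φ₁ a • φ₀) y), ← contract_smul, ← contract_add]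
      congr 2
      ext p
      simp [hD, sub_eq_add_neg]
    rw [extDerivation_ι_mul, map_add, expContract_ι_mul, expContract_ι_mul, expContract_ι_mul, ih,
      ← hy]
    simp only [map_add, map_sub, extDerivation_ι_mul, contract_extDerivation, contract_ι_mul,
      map_smul]
    have e1 : contract (A a) (contract φ₀ (contract φ₁ y)) =
        contract φ₀ (contract φ₁ (contract (A a) y)) := by
      rw [contract_comm (A a) φ₀, contract_comm (A a) φ₁, map_neg, neg_neg]
    rw [e1]
    have key' := eq_sub_of_add_eq key
    rw [key', mul_sub]
    abel

/-- Along `D` the Pfaffian changes by the insertion of the two characters `φ₀` and `φ₁`. -/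
theorem formPf_extDerivation
    (hD : ∀ u v, A (D u) v + A u (D v) = φ₀ u * φ₁ v - φ₁ u * φ₀ v) (x : Λ) :
    formPf A hA (extDerivation D x) = -formPf A hA (contract φ₀ (contract φ₁ x)) := by
  simp only [formPf, LinearMap.comp_apply, expContract_extDerivation A hA D φ₀ φ₁ hD, map_sub,
    expContract_contract, AlgHom.toLinearMap_apply]
  rw [extDerivation_apply, map_sum, Finset.sum_eq_zero fun p _ => algebraMapInv_ι_mul _ _, zero_sub]

/-- If the character `φ₀` is already present, then `D` replaces it by `φ₁ = φ₀ ∘ D`. -/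
theorem formPf_contract_extDerivation
    (hD : ∀ u v, A (D u) v + A u (D v) = φ₀ u * φ₁ v - φ₁ u * φ₀ v) (h₁ : φ₀ ∘ₗ D = φ₁) (x : Λ) :
    formPf A hA (contract φ₀ (extDerivation D x)) = formPf A hA (contract φ₁ x) := by
  rw [contract_extDerivation, map_add, formPf_extDerivation A hA D φ₀ φ₁ hD,
    contract_comm φ₁ φ₀, map_neg, contract_self, h₁]
  simp

end Derivative

/-- The polarised pairing `∑ₚ β (eₚ^* ⌋ x) (eₚ ∧ y) + β (eₚ ∧ x) (eₚ^* ⌋ y)` underlying the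
bilinear identities. -/
def pairing (β : Λ →ₗ[ℝ] Λ →ₗ[ℝ] ℝ) (x y : Λ) : ℝ :=
  ∑ p, (β (coordContract p x) (basisMul p y) + β (basisMul p x) (coordContract p y))

theorem pairing_flip (β : Λ →ₗ[ℝ] Λ →ₗ[ℝ] ℝ) (x y : Λ) :
    pairing β.flip x y = pairing β y x := by
  simp only [pairing, LinearMap.flip_apply]
  exact Finset.sum_congr rfl fun p _ => add_comm _ _

theorem sum_smul_apply_basisMul_right (β : Λ →ₗ[ℝ] Λ →ₗ[ℝ] ℝ) (a : κ → ℝ) (x y : Λ) :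
    ∑ p, a p • β x (basisMul p y) = β x (ιᵥ a * y) := by
  rw [ι_mul_eq_sum, map_sum]
  simp

theorem sum_smul_apply_basisMul_left (β : Λ →ₗ[ℝ] Λ →ₗ[ℝ] ℝ) (a : κ → ℝ) (x y : Λ) :
    ∑ p, a p • β (basisMul p x) y = β (ιᵥ a * x) y :=
  sum_smul_apply_basisMul_right β.flip a y x

/-- For a decomposable multivector `S` the sum `∑ₚ (eₚ^* ⌋ S) ⊗ (eₚ ∧ S)` vanishes. -/
theorem sum_apply_coordContract_basisMul (k : ℕ) (w : Fin k → κ → ℝ) (β : Λ →ₗ[ℝ] Λ →ₗ[ℝ] ℝ) :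
    ∑ p, β (coordContract p (ExteriorAlgebra.ιMulti ℝ k w))
      (basisMul p (ExteriorAlgebra.ιMulti ℝ k w)) = 0 := by
  induction k generalizing β with
  | zero => simp [ExteriorAlgebra.ιMulti_zero_apply, coordContract_one]
  | succ k ih =>
    rw [ExteriorAlgebra.ιMulti_succ_apply]
    set a := w 0
    set S := ExteriorAlgebra.ιMulti ℝ k (Matrix.vecTail w)
    have h1 : ∑ p, a p • β S (basisMul p (ιᵥ a * S)) = 0 := by
      rw [sum_smul_apply_basisMul_right, ← mul_assoc, ExteriorAlgebra.ι_sq_zero, zero_mul, map_zero]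
    have h2 := ih (Matrix.vecTail w)
      (β.compl₁₂ (LinearMap.mulLeft ℝ (ιᵥ a)) (LinearMap.mulLeft ℝ (ιᵥ a)))
    simp only [LinearMap.compl₁₂_apply, LinearMap.mulLeft_apply, ι_mul_basisMul, map_neg] at h2
    simp only [coordContract_ι_mul, map_sub, map_smul, LinearMap.sub_apply, LinearMap.smul_apply,
      Finset.sum_sub_distrib]
    rw [h1, zero_sub]
    simpa using h2

theorem sum_apply_basisMul_coordContract (k : ℕ) (w : Fin k → κ → ℝ) (β : Λ →ₗ[ℝ] Λ →ₗ[ℝ] ℝ) :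
    ∑ p, β (basisMul p (ExteriorAlgebra.ιMulti ℝ k w))
      (coordContract p (ExteriorAlgebra.ιMulti ℝ k w)) = 0 :=
  sum_apply_coordContract_basisMul k w β.flip

theorem pairing_one_one (β : Λ →ₗ[ℝ] Λ →ₗ[ℝ] ℝ) (k : ℕ) (w : Fin k → κ → ℝ) (a z : κ → ℝ)
    (S : Λ) (hS : S = ExteriorAlgebra.ιMulti ℝ k w) :
    pairing β (ιᵥ a * S) (ιᵥ z * S) =
    β S (ιᵥ a * (ιᵥ z * S)) + β (ιᵥ z * (ιᵥ a * S)) S := by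
  have h1 := sum_apply_coordContract_basisMul k w
    (β.compl₁₂ (LinearMap.mulLeft ℝ (ιᵥ a)) (LinearMap.mulLeft ℝ (ιᵥ z)))
  have h2 := sum_apply_basisMul_coordContract k w
    (β.compl₁₂ (LinearMap.mulLeft ℝ (ιᵥ a)) (LinearMap.mulLeft ℝ (ιᵥ z)))
  simp only [LinearMap.compl₁₂_apply, LinearMap.mulLeft_apply, ι_mul_basisMul, map_neg,
    LinearMap.neg_apply, Finset.sum_neg_distrib, neg_eq_zero, ← hS] at h1 h2
  simp only [pairing, coordContract_ι_mul, map_sub, LinearMap.sub_apply, map_smul,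
    LinearMap.smul_apply, Finset.sum_add_distrib, Finset.sum_sub_distrib,
    sum_smul_apply_basisMul_right, sum_smul_apply_basisMul_left, h1, h2]
  ring

theorem pairing_two_one (β : Λ →ₗ[ℝ] Λ →ₗ[ℝ] ℝ) (k : ℕ) (w : Fin k → κ → ℝ) (a b z : κ → ℝ)
    (S : Λ) (hS : S = ExteriorAlgebra.ιMulti ℝ k w) :
    pairing β (ιᵥ a * (ιᵥ b * S)) (ιᵥ z * S) =
    β (ιᵥ b * S) (ιᵥ a * (ιᵥ z * S)) - β (ιᵥ a * S) (ιᵥ b * (ιᵥ z * S)) +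
      β (ιᵥ z * (ιᵥ a * (ιᵥ b * S))) S := by
  have h1 := sum_apply_coordContract_basisMul k w
    (β.compl₁₂ (LinearMap.mulLeft ℝ (ιᵥ a) ∘ₗ LinearMap.mulLeft ℝ (ιᵥ b))
      (LinearMap.mulLeft ℝ (ιᵥ z)))
  have h2 := sum_apply_basisMul_coordContract k w
    (β.compl₁₂ (LinearMap.mulLeft ℝ (ιᵥ a) ∘ₗ LinearMap.mulLeft ℝ (ιᵥ b))
      (LinearMap.mulLeft ℝ (ιᵥ z)))
  simp only [LinearMap.compl₁₂_apply, LinearMap.comp_apply, LinearMap.mulLeft_apply,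
    ι_mul_basisMul, map_neg,
    Finset.sum_neg_distrib, neg_eq_zero, neg_neg, ← hS] at h1 h2
  simp only [pairing, coordContract_ι_mul, map_sub, LinearMap.sub_apply, map_smul,
    LinearMap.smul_apply, Finset.sum_add_distrib, Finset.sum_sub_distrib,
    sum_smul_apply_basisMul_right, sum_smul_apply_basisMul_left, h1, h2, mul_sub, mul_smul_comm]
  ring

section Pairings

variable (A : LinearMap.BilinForm ℝ (κ → ℝ)) (hA : A.IsAlt) (φ₀ φ₁ : Module.Dual ℝ (κ → ℝ))

local notation "Θ" => formPf A hA
local notation "Θ₀" => formPf A hA ∘ₗ contract φ₀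
local notation "Θ₁" => formPf A hA ∘ₗ contract φ₁
local notation "Θ₀₁" => formPf A hA ∘ₗ contract φ₀ ∘ₗ contract φ₁

theorem formPf_basisMul (p : κ) (x : Λ) :
    Θ (basisMul p x) = ∑ q, A (Pi.single p 1) (Pi.single q 1) * Θ (coordContract q x) := by
  rw [basisMul_apply, formPf_ι_mul, contract_eq_sum, map_sum]
  simp

/-- The fundamental bilinear identity: it expresses the skew symmetry of `A`. -/
theorem pairing_formPf (x y : Λ) : pairing (prodForm Θ Θ) x y = 0 := by
  simp only [pairing, prodForm_apply, formPf_basisMul, Finset.sum_add_distrib, Finset.mul_sum,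
    Finset.sum_mul]
  rw [add_eq_zero_iff_eq_neg, ← Finset.sum_neg_distrib, Finset.sum_comm]
  refine Finset.sum_congr rfl fun p _ => ?_
  rw [← Finset.sum_neg_distrib]
  refine Finset.sum_congr rfl fun q _ => ?_
  rw [← hA.neg_eq]
  ring

theorem sum_dual_mul_coordContract (F : Λ →ₗ[ℝ] ℝ) (d : Module.Dual ℝ (κ → ℝ)) (x : Λ) :
    ∑ p, d (Pi.single p 1) * F (coordContract p x) = F (contract d x) := by
  rw [contract_eq_sum, map_sum]
  simp

/-- The identity `pairing_formPf` with the character `φ₀` inserted into one factor. -/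
theorem pairing_formPf_contract (x y : Λ) :
    pairing (prodForm Θ Θ₀) x y = Θ₀ x * Θ y := by
  have h := pairing_formPf A hA x (contract φ₀ y)
  have hb : ∀ p, basisMul p (contract φ₀ y) =
      φ₀ (Pi.single p 1) • y - contract φ₀ (basisMul p y) := fun p => by
    rw [contract_basisMul]; abel
  have hc : ∀ p, coordContract p (contract φ₀ y) = -contract φ₀ (coordContract p y) := fun p => by
    rw [contract_coordContract, neg_neg]
  have h1 := sum_dual_mul_coordContract Θ φ₀ x
  simp only [pairing, prodForm_apply, hb, hc, map_sub, map_smul, map_neg, smul_eq_mul] at h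
  simp only [pairing, prodForm_apply, LinearMap.comp_apply]
  rw [← h1, Finset.sum_mul, ← sub_eq_zero, ← Finset.sum_sub_distrib]
  rw [← neg_eq_zero, ← Finset.sum_neg_distrib] at h
  rw [← h]
  exact Finset.sum_congr rfl fun p _ => by ring

/-- The identity `pairing_formPf` with one character inserted into each factor. -/
theorem pairing_contract_contract (x y : Λ) :
    pairing (prodForm Θ₀ Θ₁) x y = Θ₀₁ x * Θ y - Θ x * Θ₀₁ y := by
  have h := pairing_formPf A hA (contract φ₀ x) (contract φ₁ y)
  have hb : ∀ (d : Module.Dual ℝ (κ → ℝ)) p z, basisMul p (contract d z) =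
      d (Pi.single p 1) • z - contract d (basisMul p z) := fun d p z => by
    rw [contract_basisMul]; abel
  have hc : ∀ (d : Module.Dual ℝ (κ → ℝ)) p z,
      coordContract p (contract d z) = -contract d (coordContract p z) := fun d p z => by
    rw [contract_coordContract, neg_neg]
  have h1 := sum_dual_mul_coordContract Θ₀ φ₁ x
  have h2 := sum_dual_mul_coordContract Θ₁ φ₀ y
  simp only [LinearMap.comp_apply] at h1 h2
  rw [contract_comm φ₁ φ₀, map_neg] at h2
  simp only [pairing, prodForm_apply] at h
  simp only [hb, hc, map_sub, map_smul, map_neg, smul_eq_mul] at h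
  simp only [pairing, prodForm_apply, LinearMap.comp_apply]
  rw [← h1]
  have h2' := congrArg (fun r => Θ x * r) h2
  simp only [mul_neg] at h2'
  rw [sub_eq_add_neg, ← h2', Finset.mul_sum, Finset.sum_mul, ← Finset.sum_add_distrib]
  rw [← sub_eq_zero, ← Finset.sum_sub_distrib, ← h]
  exact Finset.sum_congr rfl fun p _ => by ring

/-- The identity `pairing_formPf` with both characters inserted into one factor. -/
theorem pairing_formPf_contract_contract (x y : Λ) :
    pairing (prodForm Θ Θ₀₁) x y = Θ₁ x * Θ₀ y - Θ₀ x * Θ₁ y := by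
  have h := pairing_formPf A hA x (contract φ₀ (contract φ₁ y))
  have hb : ∀ p, basisMul p (contract φ₀ (contract φ₁ y)) =
      φ₀ (Pi.single p 1) • contract φ₁ y - φ₁ (Pi.single p 1) • contract φ₀ y +
        contract φ₀ (contract φ₁ (basisMul p y)) := fun p => by
    simp only [contract_basisMul, map_sub, map_smul]; abel
  have hc : ∀ p, coordContract p (contract φ₀ (contract φ₁ y)) =
      contract φ₀ (contract φ₁ (coordContract p y)) := fun p => by
    rw [contract_coordContract, map_neg, contract_coordContract, neg_neg]
  have h0 := sum_dual_mul_coordContract Θ φ₀ x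
  have h1 := sum_dual_mul_coordContract Θ φ₁ x
  simp only [pairing, prodForm_apply, hb, hc, map_sub, map_add, map_smul, smul_eq_mul] at h
  simp only [pairing, prodForm_apply, LinearMap.comp_apply]
  rw [← h0, ← h1, Finset.sum_mul, Finset.sum_mul, ← Finset.sum_sub_distrib, ← sub_eq_zero,
    ← Finset.sum_sub_distrib, ← h]
  exact Finset.sum_congr rfl fun p _ => by ring

end Pairings

end Bilinear

/-! ### Comparison with the permutation sum -/

section PermutationSum

open Equiv

variable {V : Type*}

/-- Extension of a permutation of `m` letters by two new initial fixed points. -/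
def extendTwo {m : ℕ} (ρ : Perm (Fin m)) : Perm (Fin (m + 2)) :=
  Perm.decomposeFin.symm (0, Perm.decomposeFin.symm (0, ρ))

theorem extendTwo_zero {m : ℕ} (ρ : Perm (Fin m)) : extendTwo ρ 0 = 0 := by
  simp [extendTwo]

theorem extendTwo_one {m : ℕ} (ρ : Perm (Fin m)) : extendTwo ρ 1 = 1 := by
  rw [extendTwo, Perm.decomposeFin_symm_apply_one]
  simp

theorem extendTwo_succ_succ {m : ℕ} (ρ : Perm (Fin m)) (i : Fin m) :
    extendTwo ρ i.succ.succ = (ρ i).succ.succ := by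
  simp [extendTwo]

theorem sign_extendTwo {m : ℕ} (ρ : Perm (Fin m)) : Perm.sign (extendTwo ρ) = Perm.sign ρ := by
  simp [extendTwo, Perm.decomposeFin.symm_sign]

/-- The permutation fixing `0`, moving `j + 1` to position `1` and keeping the order of the
remaining letters. -/
def bringToOne {m : ℕ} (j : Fin (m + 1)) : Perm (Fin (m + 2)) :=
  Perm.decomposeFin.symm (0, j.cycleRange.symm)

theorem bringToOne_zero {m : ℕ} (j : Fin (m + 1)) : bringToOne j 0 = 0 := by
  simp [bringToOne]

theorem bringToOne_one {m : ℕ} (j : Fin (m + 1)) : bringToOne j 1 = j.succ := by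
  rw [bringToOne, Perm.decomposeFin_symm_apply_one, Fin.cycleRange_symm_zero]
  simp

theorem bringToOne_succ_succ {m : ℕ} (j : Fin (m + 1)) (i : Fin m) :
    bringToOne j i.succ.succ = (j.succAbove i).succ := by
  simp [bringToOne]

theorem sign_bringToOne {m : ℕ} (j : Fin (m + 1)) :
    ((Perm.sign (bringToOne j) : ℤ) : ℝ) = (-1) ^ (j : ℕ) := by
  simp [bringToOne, Perm.decomposeFin.symm_sign, Fin.sign_cycleRange]

theorem sign_mul_self_real {m : ℕ} (π : Perm (Fin m)) :
    ((Perm.sign π : ℤ) : ℝ) * ((Perm.sign π : ℤ) : ℝ) = 1 := by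
  rw [← Int.cast_mul, ← Units.val_mul, Int.units_mul_self]
  simp

/-- In an alternating sum over all permutations, a function of the last `m` letters may be
antisymmetrised at the cost of a factor `m !`. -/
theorem sum_sign_mul_alternate {m : ℕ} (B : V → V → ℝ) (G : (Fin m → V) → ℝ)
    (w : Fin (m + 2) → V) :
    ∑ π : Perm (Fin (m + 2)), ((Perm.sign π : ℤ) : ℝ) * (B (w (π 0)) (w (π 1)) *
        ∑ ρ : Perm (Fin m), ((Perm.sign ρ : ℤ) : ℝ) * G (fun i => w (π (ρ i).succ.succ))) =
      (m ! : ℝ) * ∑ π : Perm (Fin (m + 2)), ((Perm.sign π : ℤ) : ℝ) *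
        (B (w (π 0)) (w (π 1)) * G (fun i => w (π i.succ.succ))) := by
  simp only [Finset.mul_sum]
  rw [Finset.sum_comm]
  have h : ∀ ρ : Perm (Fin m), ∑ π : Perm (Fin (m + 2)), ((Perm.sign π : ℤ) : ℝ) *
      (B (w (π 0)) (w (π 1)) * (((Perm.sign ρ : ℤ) : ℝ) * G (fun i => w (π (ρ i).succ.succ)))) =
      ∑ π : Perm (Fin (m + 2)), ((Perm.sign π : ℤ) : ℝ) *
        (B (w (π 0)) (w (π 1)) * G (fun i => w (π i.succ.succ))) := fun ρ => by
    rw [← Equiv.sum_comp (Equiv.mulRight (extendTwo ρ))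
      (fun π => ((Perm.sign π : ℤ) : ℝ) *
        (B (w (π 0)) (w (π 1)) * G (fun i => w (π i.succ.succ))))]
    refine Finset.sum_congr rfl fun π _ => ?_
    simp only [Equiv.coe_mulRight, Perm.mul_apply, extendTwo_zero, extendTwo_one,
      extendTwo_succ_succ, Perm.sign_mul, sign_extendTwo, Units.val_mul, Int.cast_mul]
    ring
  rw [Finset.sum_congr rfl fun ρ _ => h ρ, Finset.sum_const, Finset.card_univ, Fintype.card_perm,
    Fintype.card_fin, nsmul_eq_mul]
  simp only [Finset.mul_sum]

variable [AddCommGroup V] [Module ℝ V] (A : LinearMap.BilinForm ℝ V) (hA : A.IsAlt)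

/-- The first row expansion, antisymmetrised: all `m + 1` terms of the expansion contribute
equally. -/
theorem sum_sign_mul_formPf (m : ℕ) (w : Fin (m + 2) → V) :
    ((m + 1 : ℕ) : ℝ) * ∑ π : Perm (Fin (m + 2)), ((Perm.sign π : ℤ) : ℝ) *
      (A (w (π 0)) (w (π 1)) *
        formPf A hA (ExteriorAlgebra.ιMulti ℝ m (fun i => w (π i.succ.succ)))) =
    ((m + 2)! : ℝ) * formPf A hA (ExteriorAlgebra.ιMulti ℝ (m + 2) w) := by
  have h1 : ∀ π : Perm (Fin (m + 2)), ((Perm.sign π : ℤ) : ℝ) *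
      formPf A hA (ExteriorAlgebra.ιMulti ℝ (m + 2) (w ∘ π)) =
      formPf A hA (ExteriorAlgebra.ιMulti ℝ (m + 2) w) := fun π => by
    rw [AlternatingMap.map_perm, Units.smul_def, ← Int.cast_smul_eq_zsmul ℝ, map_smul,
      smul_eq_mul, ← mul_assoc, sign_mul_self_real, one_mul]
  have h2 : ((m + 2)! : ℝ) * formPf A hA (ExteriorAlgebra.ιMulti ℝ (m + 2) w) =
      ∑ π : Perm (Fin (m + 2)), ((Perm.sign π : ℤ) : ℝ) *
        formPf A hA (ExteriorAlgebra.ιMulti ℝ (m + 2) (w ∘ π)) := by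
    rw [Finset.sum_congr rfl fun π _ => h1 π, Finset.sum_const, Finset.card_univ,
      Fintype.card_perm, Fintype.card_fin, nsmul_eq_mul]
  rw [h2]
  simp only [formPf_ιMulti_succ, Finset.mul_sum]
  rw [Finset.sum_comm]
  have h3 : ∀ j : Fin (m + 1), ∑ π : Perm (Fin (m + 2)), ((Perm.sign π : ℤ) : ℝ) *
      ((-1 : ℝ) ^ (j : ℕ) * A ((w ∘ π) 0) ((w ∘ π) j.succ) *
        formPf A hA (ExteriorAlgebra.ιMulti ℝ m fun i => (w ∘ π) (j.succAbove i).succ)) =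
      ∑ π : Perm (Fin (m + 2)), ((Perm.sign π : ℤ) : ℝ) *
      (A (w (π 0)) (w (π 1)) *
        formPf A hA (ExteriorAlgebra.ιMulti ℝ m (fun i => w (π i.succ.succ)))) := fun j => by
    rw [← Equiv.sum_comp (Equiv.mulRight (bringToOne j))
      (fun π => ((Perm.sign π : ℤ) : ℝ) * (A (w (π 0)) (w (π 1)) *
        formPf A hA (ExteriorAlgebra.ιMulti ℝ m (fun i => w (π i.succ.succ)))))]
    refine Finset.sum_congr rfl fun π _ => ?_
    simp only [Equiv.coe_mulRight, Perm.mul_apply, bringToOne_zero, bringToOne_one,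
      bringToOne_succ_succ, Perm.sign_mul, sign_bringToOne, Units.val_mul, Int.cast_mul,
      Function.comp_apply]
    ring
  rw [Finset.sum_congr rfl fun j _ => h3 j, Finset.sum_const, Finset.card_univ, Fintype.card_fin,
    nsmul_eq_mul, Finset.mul_sum]

theorem sum_sign_mul_prod_eq_formPf (N : ℕ) (w : Fin (2 * N) → V) :
    ∑ π : Perm (Fin (2 * N)), ((Perm.sign π : ℤ) : ℝ) *
      ∏ l : Fin N, A (w (π ⟨2 * l.1, by omega⟩)) (w (π ⟨2 * l.1 + 1, by omega⟩)) =
    (2 : ℝ) ^ N * (N ! : ℝ) * formPf A hA (ExteriorAlgebra.ιMulti ℝ (2 * N) w) := by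
  induction N with
  | zero =>
    have h : ExteriorAlgebra.ιMulti ℝ (2 * 0) w = 1 := ExteriorAlgebra.ιMulti_zero_apply w
    rw [h, formPf_one]
    simp
  | succ N ih =>
    let G : (Fin (2 * N) → V) → ℝ := fun u =>
      ∏ l : Fin N, A (u ⟨2 * l.1, by omega⟩) (u ⟨2 * l.1 + 1, by omega⟩)
    have h1 := sum_sign_mul_alternate (m := 2 * N) (fun u v => A u v) G w
    have h2 := sum_sign_mul_formPf A hA (2 * N) w
    have h3 : ∀ π : Perm (Fin (2 * N + 2)),
        ∑ ρ : Perm (Fin (2 * N)), ((Perm.sign ρ : ℤ) : ℝ) * G (fun i => w (π (ρ i).succ.succ)) =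
        (2 : ℝ) ^ N * (N ! : ℝ) *
          formPf A hA (ExteriorAlgebra.ιMulti ℝ (2 * N) (fun i => w (π i.succ.succ))) :=
      fun π => ih (fun i => w (π i.succ.succ))
    simp only [h3] at h1
    have h4 : ∑ π : Perm (Fin (2 * (N + 1))), ((Perm.sign π : ℤ) : ℝ) *
        ∏ l : Fin (N + 1), A (w (π ⟨2 * l.1, by omega⟩)) (w (π ⟨2 * l.1 + 1, by omega⟩)) =
        ∑ π : Perm (Fin (2 * N + 2)), ((Perm.sign π : ℤ) : ℝ) *
        (A (w (π 0)) (w (π 1)) * G (fun i => w (π i.succ.succ))) := by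
      refine Finset.sum_congr rfl fun π _ => ?_
      rw [Fin.prod_univ_succ]
      rfl
    rw [h4]
    set X := ∑ π : Perm (Fin (2 * N + 2)), ((Perm.sign π : ℤ) : ℝ) *
        (A (w (π 0)) (w (π 1)) * G (fun i => w (π i.succ.succ)))
    set Y := ∑ π : Perm (Fin (2 * N + 2)), ((Perm.sign π : ℤ) : ℝ) *
      (A (w (π 0)) (w (π 1)) *
        formPf A hA (ExteriorAlgebra.ιMulti ℝ (2 * N) (fun i => w (π i.succ.succ)))) with hY
    have h5 : (2 : ℝ) ^ N * (N ! : ℝ) * Y = ((2 * N)! : ℝ) * X := by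
      rw [← h1, hY, Finset.mul_sum]
      exact Finset.sum_congr rfl fun π _ => by ring
    have h6 : ((2 * N)! : ℝ) ≠ 0 := by positivity
    have h7 : ((2 * N + 1 : ℕ) : ℝ) ≠ 0 := by positivity
    have h8 : ((2 * N + 2)! : ℝ) = (2 * N + 2) * ((2 * N + 1 : ℕ) : ℝ) * ((2 * N)! : ℝ) := by
      rw [Nat.factorial_succ, Nat.factorial_succ]; push_cast; ring
    rw [h8] at h2
    refine mul_left_cancel₀ h6 (mul_left_cancel₀ h7 ?_)
    rw [← h5]
    have h9 : ((N + 1)! : ℝ) = (N + 1) * (N ! : ℝ) := by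
      rw [Nat.factorial_succ]; push_cast; ring
    rw [h9]
    change _ = ((2 * N + 1 : ℕ) : ℝ) * (((2 * N)! : ℝ) * (2 ^ (N + 1) * ((N + 1) * (N ! : ℝ)) *
      formPf A hA (ExteriorAlgebra.ιMulti ℝ (2 * N + 2) w)))
    linear_combination ((2 : ℝ) ^ N * (N ! : ℝ)) * h2

/-- The Pfaffian defined by the sum over permutations is the functional `formPf`. -/
theorem pfaffian_eq_formPf (N : ℕ) (w : Fin (2 * N) → V) :
    pfaffian (N := N) (fun a b => A (w a) (w b)) =
      formPf A hA (ExteriorAlgebra.ιMulti ℝ (2 * N) w) := by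
  unfold pfaffian
  rw [sum_sign_mul_prod_eq_formPf A hA]
  have : (2 : ℝ) ^ N * (N ! : ℝ) ≠ 0 := by positivity
  field_simp

end PermutationSum

/-- Expansion along the first row of the Pfaffian of a skew-symmetric matrix. -/
theorem pfaffian_succ (N : ℕ) (M : Matrix (Fin (2 * N + 2)) (Fin (2 * N + 2)) ℝ)
    (hM : ∀ a b, M a b = -M b a) :
    pfaffian (N := N + 1) M = ∑ j : Fin (2 * N + 1), (-1 : ℝ) ^ (j : ℕ) * M 0 j.succ *
      pfaffian (N := N) (fun a b => M (j.succAbove a).succ (j.succAbove b).succ) := by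
  let A := Matrix.toBilin' M
  have hM' : ∀ a b, A (Pi.single a 1) (Pi.single b 1) = M a b := Matrix.toBilin'_single M
  have hA : A.IsAlt := by
    intro v
    have h : A v v = -A v v := by
      simp only [A, Matrix.toBilin'_apply]
      rw [← Finset.sum_neg_distrib, Finset.sum_comm]
      refine Finset.sum_congr rfl fun a _ => ?_
      rw [← Finset.sum_neg_distrib]
      refine Finset.sum_congr rfl fun b _ => ?_
      rw [hM b a]
      ring
    linarith
  have h := formPf_ιMulti_succ A hA (2 * N)
    (fun a : Fin (2 * N + 2) => (Pi.single a 1 : Fin (2 * N + 2) → ℝ))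
  have h0 := pfaffian_eq_formPf A hA (N + 1)
    (fun a : Fin (2 * N + 2) => (Pi.single a 1 : Fin (2 * N + 2) → ℝ))
  simp only [hM'] at h h0
  refine h0.trans (h.trans (Finset.sum_congr rfl fun j _ => ?_))
  rw [← pfaffian_eq_formPf A hA N]
  simp only [hM']

/-! ### The Pfaffian entries -/

section Entries

variable {n : ℕ}

/-- The vector `(ζ_p ^ l b_p(t))_p`. -/
def momentVec (ζ β : Fin n → ℝ) (l : ℤ) (t : ℝ) : Fin n → ℝ :=
  fun p => ζ p ^ l * (β p * Real.exp (ζ p * t))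

/-- The sum of the coordinates. -/
def sumDual (n : ℕ) : Module.Dual ℝ (Fin n → ℝ) := ∑ p, LinearMap.proj p

theorem sumDual_apply (v : Fin n → ℝ) : sumDual n v = ∑ p, v p := by
  simp [sumDual, LinearMap.sum_apply]

/-- The alternating form with Schur's matrix `(ζ_q - ζ_p) / (α + ζ_p + ζ_q)`. -/
def schurForm (α : ℝ) (ζ : Fin n → ℝ) : LinearMap.BilinForm ℝ (Fin n → ℝ) :=
  Matrix.toBilin' (fun p q => (ζ q - ζ p) / (α + ζ p + ζ q))

theorem schurForm_apply (α : ℝ) (ζ : Fin n → ℝ) (u v : Fin n → ℝ) :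
    schurForm α ζ u v = ∑ p, ∑ q, u p * ((ζ q - ζ p) / (α + ζ p + ζ q)) * v q :=
  Matrix.toBilin'_apply _ _ _

theorem schurForm_single (α : ℝ) (ζ : Fin n → ℝ) (p q : Fin n) :
    schurForm α ζ (Pi.single p 1) (Pi.single q 1) = (ζ q - ζ p) / (α + ζ p + ζ q) :=
  Matrix.toBilin'_single _ _ _

theorem schurForm_isAlt (α : ℝ) (ζ : Fin n → ℝ) : (schurForm α ζ).IsAlt := by
  intro v
  have h : schurForm α ζ v v = -schurForm α ζ v v := by
    simp only [schurForm_apply]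
    rw [← Finset.sum_neg_distrib, Finset.sum_comm]
    refine Finset.sum_congr rfl fun p _ => ?_
    rw [← Finset.sum_neg_distrib]
    refine Finset.sum_congr rfl fun q _ => ?_
    rw [show α + ζ q + ζ p = α + ζ p + ζ q by ring]
    ring
  linarith

theorem f_eq_sumDual (ζ β : Fin n → ℝ) (i : ℤ) (t : ℝ) :
    f ζ β i t = sumDual n (momentVec ζ β i t) := by
  rw [sumDual_apply]
  rfl

theorem integrableOn_exp_mul_Iio {a : ℝ} (ha : 0 < a) (t : ℝ) :
    IntegrableOn (fun s => Real.exp (a * s)) (Set.Iio t) :=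
  (integrableOn_exp_mul_Iic ha t).mono_set Set.Iio_subset_Iic_self

theorem integral_exp_mul_Iio {a : ℝ} (ha : 0 < a) (t : ℝ) :
    ∫ s in Set.Iio t, Real.exp (a * s) = Real.exp (a * t) / a := by
  rw [← integral_Iic_eq_integral_Iio, integral_exp_mul_Iic ha]

variable {α : ℝ} {ζ : Fin n → ℝ} (β : Fin n → ℝ)

theorem integrableOn_f (hζ : ∀ p, 0 < ζ p) (i : ℤ) (t : ℝ) :
    IntegrableOn (f ζ β i) (Set.Iio t) := by
  refine integrable_finsetSum _ fun p _ => ?_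
  exact ((integrableOn_exp_mul_Iio (hζ p) t).const_mul (β p)).const_mul (ζ p ^ i)

theorem integral_f (hζ : ∀ p, 0 < ζ p) (i : ℤ) (t : ℝ) :
    ∫ s in Set.Iio t, f ζ β (i + 1) s = f ζ β i t := by
  simp only [f]
  rw [integral_finsetSum]
  · refine Finset.sum_congr rfl fun p _ => ?_
    rw [integral_const_mul, integral_const_mul, integral_exp_mul_Iio (hζ p),
      zpow_add_one₀ (hζ p).ne']
    have := (hζ p).ne'
    field_simp
  · intro p _
    exact ((integrableOn_exp_mul_Iio (hζ p) t).const_mul (β p)).const_mul _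

theorem entryInt_eq_schurForm (hα : 0 ≤ α) (hζ : ∀ p, 0 < ζ p) (t : ℝ) (i j : ℤ) :
    entryInt α ζ β t i j = schurForm α ζ (momentVec ζ β i t) (momentVec ζ β j t) := by
  have hinner : ∀ s, ∫ t₁ in Set.Iio s, Real.exp (α * s) *
        (f ζ β (i + 1) t₁ * f ζ β (j + 1) s - f ζ β (i + 1) s * f ζ β (j + 1) t₁) =
      ∑ p, ∑ q, (ζ p ^ i * β p * (ζ q ^ j * β q) * (ζ q - ζ p)) *
        Real.exp ((α + ζ p + ζ q) * s) := fun s => by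
    rw [integral_const_mul, integral_sub ((integrableOn_f β hζ _ _).mul_const _)
      ((integrableOn_f β hζ _ _).const_mul _), integral_mul_const, integral_const_mul,
      integral_f β hζ, integral_f β hζ]
    unfold f
    rw [Finset.sum_mul_sum, Finset.sum_mul_sum]
    simp only [← Finset.sum_sub_distrib, Finset.mul_sum]
    refine Finset.sum_congr rfl fun p _ => Finset.sum_congr rfl fun q _ => ?_
    rw [zpow_add_one₀ (hζ p).ne', zpow_add_one₀ (hζ q).ne',
      show (α + ζ p + ζ q) * s = α * s + ζ p * s + ζ q * s by ring, Real.exp_add, Real.exp_add]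
    ring
  have hpos : ∀ p q, 0 < α + ζ p + ζ q := fun p q => by linarith [hζ p, hζ q]
  have hint : ∀ p q, Integrable (fun s => (ζ p ^ i * β p * (ζ q ^ j * β q) * (ζ q - ζ p)) *
      Real.exp ((α + ζ p + ζ q) * s)) (volume.restrict (Set.Iio t)) := fun p q =>
    (integrableOn_exp_mul_Iio (hpos p q) t).const_mul _
  rw [entryInt]
  simp only [hinner]
  rw [integral_finsetSum _ fun p _ => integrable_finsetSum _ fun q _ => hint p q,
    schurForm_apply, Finset.mul_sum]
  refine Finset.sum_congr rfl fun p _ => ?_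
  rw [integral_finsetSum _ fun q _ => hint p q, Finset.mul_sum]
  refine Finset.sum_congr rfl fun q _ => ?_
  rw [integral_const_mul, integral_exp_mul_Iio (hpos p q),
    show (α + ζ p + ζ q) * t = α * t + ζ p * t + ζ q * t by ring, Real.exp_add, Real.exp_add]
  have h1 : Real.exp (-α * t) * Real.exp (α * t) = 1 := by
    rw [← Real.exp_add]; simp
  simp only [momentVec]
  linear_combination (ζ p ^ i * β p * (ζ q ^ j * β q) * (ζ q - ζ p) *
    (Real.exp (ζ p * t) * Real.exp (ζ q * t)) / (α + ζ p + ζ q)) * h1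

/-- The multivector `v_l ∧ v_{l+1} ∧ ⋯ ∧ v_{l+k-1}` with `v_i = (ζ_p ^ i b_p(t))_p`. -/
def momentWedge (ζ β : Fin n → ℝ) (l : ℤ) (k : ℕ) (t : ℝ) : ExteriorAlgebra ℝ (Fin n → ℝ) :=
  ExteriorAlgebra.ιMulti ℝ k (fun a : Fin k => momentVec ζ β (l + (a : ℕ)) t)

/-- The Pfaffian of a multivector of degree `k`, with the character `d₀` put in front if `k` is
odd. -/
def charPf (α : ℝ) (ζ : Fin n → ℝ) (k : ℕ) : ExteriorAlgebra ℝ (Fin n → ℝ) →ₗ[ℝ] ℝ :=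
  if Even k then formPf (schurForm α ζ) (schurForm_isAlt α ζ)
  else formPf (schurForm α ζ) (schurForm_isAlt α ζ) ∘ₗ contract (sumDual n)

theorem charPf_even {k : ℕ} (hk : Even k) (x : ExteriorAlgebra ℝ (Fin n → ℝ)) :
    charPf α ζ k x = formPf (schurForm α ζ) (schurForm_isAlt α ζ) x := by
  rw [charPf, if_pos hk]

theorem charPf_odd {k : ℕ} (hk : ¬Even k) (x : ExteriorAlgebra ℝ (Fin n → ℝ)) :
    charPf α ζ k x =
      formPf (schurForm α ζ) (schurForm_isAlt α ζ) (contract (sumDual n) x) := by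
  rw [charPf, if_neg hk]
  rfl

theorem pfSeq_eq_charPf (hα : 0 ≤ α) (hζ : ∀ p, 0 < ζ p) (l : ℤ) (k : ℕ) (t : ℝ) :
    pfSeq α ζ β l k t = charPf α ζ k (momentWedge ζ β l k t) := by
  have hentry : ∀ i j : ℤ, entry α ζ β t (.num i) (.num j) =
      schurForm α ζ (momentVec ζ β i t) (momentVec ζ β j t) :=
    fun i j => entryInt_eq_schurForm β hα hζ t i j
  change (if Even k then pfWord α ζ β t (k / 2) (evenWord l)
      else pfWord α ζ β t ((k + 1) / 2) (oddWord l)) = _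
  by_cases hk : Even k
  · obtain ⟨N, rfl⟩ := hk.two_dvd
    rw [if_pos hk, charPf_even hk, Nat.mul_div_cancel_left N two_pos]
    simp only [pfWord, evenWord, hentry]
    exact pfaffian_eq_formPf (schurForm α ζ) (schurForm_isAlt α ζ) N
      (fun a => momentVec ζ β (l + (a : ℕ)) t)
  · obtain ⟨N, rfl⟩ := Nat.not_even_iff_odd.mp hk
    rw [if_neg hk, charPf_odd hk, show (2 * N + 1 + 1) / 2 = N + 1 by omega, momentWedge,
      contract_ιMulti, map_sum, pfWord]
    refine (pfaffian_succ N _ ?_).trans ?_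
    · intro a b
      cases oddWord l a <;> cases oddWord l b
      · simp [entry]
      · simp [entry]
      · simp [entry]
      · rw [hentry, hentry, (schurForm_isAlt α ζ).neg_eq]
    · refine Finset.sum_congr rfl fun j _ => ?_
      rw [map_smul, smul_eq_mul]
      simp only [Fin.val_succ, Fin.val_zero, oddWord, hentry]
      rw [pfaffian_eq_formPf (schurForm α ζ) (schurForm_isAlt α ζ) N
        (fun a => momentVec ζ β (l + ((j.succAbove a : Fin (2 * N + 1)) : ℕ)) t)]
      simp only [entry, f_eq_sumDual]
      rfl

end Entries

/-! ### Bilinear equations for the tau functions -/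

section Wedge

variable {n : ℕ} {ζ : Fin n → ℝ} (β : Fin n → ℝ)

theorem momentWedge_zero (l : ℤ) (t : ℝ) : momentWedge ζ β l 0 t = 1 :=
  ExteriorAlgebra.ιMulti_zero_apply _

theorem momentWedge_succ (l : ℤ) (k : ℕ) (t : ℝ) :
    momentWedge ζ β l (k + 1) t =
      ExteriorAlgebra.ι ℝ (momentVec ζ β l t) * momentWedge ζ β (l + 1) k t := by
  rw [momentWedge, ExteriorAlgebra.ιMulti_succ_apply, momentWedge]
  congr 2
  · simp
  · funext a
    simp only [Matrix.vecTail, Function.comp_apply, Fin.val_succ]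
    congr 1
    push_cast
    ring

theorem momentWedge_succ_right (l : ℤ) (k : ℕ) (t : ℝ) :
    momentWedge ζ β l (k + 1) t =
      momentWedge ζ β l k t * ExteriorAlgebra.ι ℝ (momentVec ζ β (l + k) t) := by
  induction k generalizing l with
  | zero => simp [momentWedge_succ, momentWedge_zero]
  | succ k ih =>
    rw [momentWedge_succ, ih, momentWedge_succ β l k, mul_assoc]
    congr 4
    push_cast
    ring

theorem ι_mul_momentWedge (u : Fin n → ℝ) (l : ℤ) (k : ℕ) (t : ℝ) :
    momentWedge ζ β l k t * ExteriorAlgebra.ι ℝ u =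
      (-1 : ℝ) ^ k • (ExteriorAlgebra.ι ℝ u * momentWedge ζ β l k t) := by
  induction k generalizing l with
  | zero => simp [momentWedge_zero]
  | succ k ih =>
    rw [momentWedge_succ, mul_assoc, ih, mul_smul_comm, ← mul_assoc, ← mul_assoc,
      eq_neg_of_add_eq_zero_left (ExteriorAlgebra.ι_add_mul_swap (momentVec ζ β l t) u), pow_succ]
    simp

theorem mul_momentVec (hζ : ∀ p, 0 < ζ p) (l : ℤ) (t : ℝ) :
    LinearMap.mulLeft ℝ ζ (momentVec ζ β l t) = momentVec ζ β (l + 1) t := by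
  funext p
  simp only [LinearMap.mulLeft_apply, Pi.mul_apply, momentVec, zpow_add_one₀ (hζ p).ne']
  ring

/-- Only the shift of the last vector survives: every other shifted vector occurs already. -/
theorem extDerivation_momentWedge (hζ : ∀ p, 0 < ζ p) (l : ℤ) (k : ℕ) (t : ℝ) :
    extDerivation (LinearMap.mulLeft ℝ ζ) (momentWedge ζ β l (k + 1) t) =
      momentWedge ζ β l k t * ExteriorAlgebra.ι ℝ (momentVec ζ β (l + k + 1) t) := by
  induction k generalizing l with
  | zero =>
    rw [momentWedge_succ, momentWedge_zero, momentWedge_zero, extDerivation_ι_mul,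
      extDerivation_one, mul_momentVec β hζ]
    simp
  | succ k ih =>
    rw [momentWedge_succ, extDerivation_ι_mul, ih, mul_momentVec β hζ,
      momentWedge_succ β (l + 1) k, ← mul_assoc, ExteriorAlgebra.ι_sq_zero, zero_mul, zero_add,
      momentWedge_succ β l k, mul_assoc]
    congr 4
    push_cast
    ring

/-- Adding the constant `α / 2` to the multiplier adds `α / 2` times the degree. -/
theorem extDerivation_shift_momentWedge (α : ℝ) (l : ℤ) (k : ℕ) (t : ℝ) :
    extDerivation (LinearMap.mulLeft ℝ (fun p => ζ p + α / 2)) (momentWedge ζ β l k t) =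
      extDerivation (LinearMap.mulLeft ℝ ζ) (momentWedge ζ β l k t) +
        (k * (α / 2)) • momentWedge ζ β l k t := by
  have hD : ∀ v : Fin n → ℝ, LinearMap.mulLeft ℝ (fun p => ζ p + α / 2) v =
      LinearMap.mulLeft ℝ ζ v + (α / 2) • v := fun v => by
    funext p
    simp only [LinearMap.mulLeft_apply, Pi.mul_apply, Pi.add_apply, Pi.smul_apply, smul_eq_mul]
    ring
  induction k generalizing l with
  | zero => simp [momentWedge_zero, extDerivation_one]
  | succ k ih =>
    rw [momentWedge_succ, extDerivation_ι_mul, extDerivation_ι_mul, ih, hD, map_add, map_smul,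
      add_mul, mul_add, smul_mul_assoc, mul_smul_comm]
    push_cast
    rw [add_mul (k : ℝ), one_mul, add_smul]
    abel

/-- Differentiating in `t` amounts to applying the derivation that extends `e_p ↦ ζ_p e_p`. -/
theorem hasDerivAt_momentWedge (F : ExteriorAlgebra ℝ (Fin n → ℝ) →ₗ[ℝ] ℝ) (l : ℤ) (k : ℕ)
    (t : ℝ) :
    HasDerivAt (fun t => F (momentWedge ζ β l k t))
      (F (extDerivation (LinearMap.mulLeft ℝ ζ) (momentWedge ζ β l k t))) t := by
  induction k generalizing l F with
  | zero =>
    simp only [momentWedge_zero, extDerivation_one, map_zero]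
    exact hasDerivAt_const _ _
  | succ k ih =>
    have hv : ∀ p, HasDerivAt (fun t => momentVec ζ β l t p)
        (LinearMap.mulLeft ℝ ζ (momentVec ζ β l t) p) t := fun p => by
      have h := (((hasDerivAt_id t).const_mul (ζ p)).exp.const_mul (β p)).const_mul (ζ p ^ l)
      refine h.congr_deriv ?_
      simp only [LinearMap.mulLeft_apply, Pi.mul_apply, momentVec, id]
      ring
    have h1 : ∀ (a : Fin n → ℝ) y, F (ExteriorAlgebra.ι ℝ a * y) =
        ∑ p, a p * F (basisMul p y) := fun a y => by
      rw [ι_mul_eq_sum, map_sum]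
      simp
    simp only [momentWedge_succ]
    rw [extDerivation_ι_mul, map_add, h1, h1, ← Finset.sum_add_distrib]
    simp only [h1]
    refine HasDerivAt.fun_sum fun p _ => ?_
    exact (hv p).mul (ih (F ∘ₗ basisMul p) (l + 1))

end Wedge

section Identities

variable {n : ℕ} {α : ℝ} {ζ : Fin n → ℝ}

theorem ι_mul_ι_mul (a b : Fin n → ℝ) (x : ExteriorAlgebra ℝ (Fin n → ℝ)) :
    ExteriorAlgebra.ι ℝ a * (ExteriorAlgebra.ι ℝ b * x) =
      -(ExteriorAlgebra.ι ℝ b * (ExteriorAlgebra.ι ℝ a * x)) := by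
  rw [← mul_assoc, ← mul_assoc, eq_neg_of_add_eq_zero_left (ExteriorAlgebra.ι_add_mul_swap a b),
    neg_mul]

/-- Along multiplication by `ζ + α / 2` the form with matrix `(ζ_q - ζ_p) / (α + ζ_p + ζ_q)` changes
by a form of rank two, since the factor `α + ζ_p + ζ_q` cancels. -/
theorem schurForm_mulLeft (hα : 0 ≤ α) (hζ : ∀ p, 0 < ζ p) (u v : Fin n → ℝ) :
    schurForm α ζ (LinearMap.mulLeft ℝ (fun p => ζ p + α / 2) u) v +
      schurForm α ζ u (LinearMap.mulLeft ℝ (fun p => ζ p + α / 2) v) =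
    sumDual n u * (sumDual n ∘ₗ LinearMap.mulLeft ℝ (fun p => ζ p + α / 2)) v -
      (sumDual n ∘ₗ LinearMap.mulLeft ℝ (fun p => ζ p + α / 2)) u * sumDual n v := by
  simp only [schurForm_apply, LinearMap.comp_apply, sumDual_apply, LinearMap.mulLeft_apply,
    Pi.mul_apply, Finset.sum_mul_sum, ← Finset.sum_add_distrib, ← Finset.sum_sub_distrib]
  refine Finset.sum_congr rfl fun p _ => Finset.sum_congr rfl fun q _ => ?_
  have : α + ζ p + ζ q ≠ 0 := by linarith [hζ p, hζ q]
  field_simp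
  ring

/-- The four-letter Pfaffian identity for the letters `a`, `b`, `z`, `d₀`. -/
theorem charPf_quadratic (k : ℕ) (w : Fin k → Fin n → ℝ) (a b z : Fin n → ℝ)
    (S : ExteriorAlgebra ℝ (Fin n → ℝ)) (hS : S = ExteriorAlgebra.ιMulti ℝ k w) :
    charPf α ζ (k + 1) (ExteriorAlgebra.ι ℝ b * S) *
        charPf α ζ (k + 2) (ExteriorAlgebra.ι ℝ z * (ExteriorAlgebra.ι ℝ a * S)) -
      charPf α ζ (k + 1) (ExteriorAlgebra.ι ℝ a * S) *
        charPf α ζ (k + 2) (ExteriorAlgebra.ι ℝ z * (ExteriorAlgebra.ι ℝ b * S)) =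
    charPf α ζ k S * charPf α ζ (k + 3)
        (ExteriorAlgebra.ι ℝ z * (ExteriorAlgebra.ι ℝ a * (ExteriorAlgebra.ι ℝ b * S))) -
      charPf α ζ (k + 2) (ExteriorAlgebra.ι ℝ a * (ExteriorAlgebra.ι ℝ b * S)) *
        charPf α ζ (k + 1) (ExteriorAlgebra.ι ℝ z * S) := by
  rw [ι_mul_ι_mul z a S, ι_mul_ι_mul z b S, map_neg, map_neg]
  by_cases hk : Even k
  · have h1 : ¬Even (k + 1) := by simp [Nat.even_add_one, hk]
    have h2 : Even (k + 2) := by simp [Nat.even_add_one, hk]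
    have h3 : ¬Even (k + 3) := by simp [Nat.even_add_one, hk]
    simp only [charPf_even hk, charPf_odd h1, charPf_even h2, charPf_odd h3]
    have h := pairing_two_one (prodForm (formPf (schurForm α ζ) (schurForm_isAlt α ζ))
      (formPf (schurForm α ζ) (schurForm_isAlt α ζ) ∘ₗ contract (sumDual n))).flip k w a b z S hS
    rw [pairing_flip, pairing_formPf_contract] at h
    simp only [LinearMap.flip_apply, prodForm_apply, LinearMap.comp_apply] at h
    linear_combination h
  · have h1 : Even (k + 1) := by simp [Nat.even_add_one, hk]
    have h2 : ¬Even (k + 2) := by simp [Nat.even_add_one, hk]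
    have h3 : Even (k + 3) := by simp [Nat.even_add_one, hk]
    simp only [charPf_odd hk, charPf_even h1, charPf_odd h2, charPf_even h3]
    have h := pairing_two_one (prodForm (formPf (schurForm α ζ) (schurForm_isAlt α ζ))
      (formPf (schurForm α ζ) (schurForm_isAlt α ζ) ∘ₗ contract (sumDual n))) k w a b z S hS
    rw [pairing_formPf_contract] at h
    simp only [prodForm_apply, LinearMap.comp_apply] at h
    linear_combination h

/-- The four-letter Pfaffian identity for the letters `a`, `z`, `d₀` and the second character `d₁`
with `(d₁, i) = ∑ₚ (ζₚ + α / 2) ζₚ ^ i bₚ`; the Pfaffians that contain `d₁` have been rewritten by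
means of the derivation that extends multiplication by `ζ + α / 2`. -/
theorem charPf_quadratic_deriv (hα : 0 ≤ α) (hζ : ∀ p, 0 < ζ p) (k : ℕ) (w : Fin k → Fin n → ℝ)
    (a z : Fin n → ℝ) (S : ExteriorAlgebra ℝ (Fin n → ℝ))
    (hS : S = ExteriorAlgebra.ιMulti ℝ k w)
    (D : ExteriorAlgebra ℝ (Fin n → ℝ) →ₗ[ℝ] ExteriorAlgebra ℝ (Fin n → ℝ))
    (hD : D = extDerivation (LinearMap.mulLeft ℝ (fun p => ζ p + α / 2))) :
    charPf α ζ (k + 2) (D (ExteriorAlgebra.ι ℝ z * (ExteriorAlgebra.ι ℝ a * S))) *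
        charPf α ζ k S -
      charPf α ζ (k + 2) (ExteriorAlgebra.ι ℝ z * (ExteriorAlgebra.ι ℝ a * S)) *
        charPf α ζ k (D S) =
    charPf α ζ (k + 1) (ExteriorAlgebra.ι ℝ z * S) *
        charPf α ζ (k + 1) (D (ExteriorAlgebra.ι ℝ a * S)) -
      charPf α ζ (k + 1) (D (ExteriorAlgebra.ι ℝ z * S)) *
        charPf α ζ (k + 1) (ExteriorAlgebra.ι ℝ a * S) := by
  have hrel := schurForm_mulLeft hα hζ
  have hΘ := formPf_extDerivation (schurForm α ζ) (schurForm_isAlt α ζ) _ _ _ hrel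
  have hΘ₀ := formPf_contract_extDerivation (schurForm α ζ) (schurForm_isAlt α ζ) _ _ _ hrel rfl
  by_cases hk : Even k
  · have h1 : ¬Even (k + 1) := by simp [Nat.even_add_one, hk]
    have h2 : Even (k + 2) := by simp [Nat.even_add_one, hk]
    simp only [charPf_even hk, charPf_odd h1, charPf_even h2, hD, hΘ, hΘ₀]
    have h := pairing_one_one (prodForm (formPf (schurForm α ζ) (schurForm_isAlt α ζ))
      (formPf (schurForm α ζ) (schurForm_isAlt α ζ) ∘ₗ contract (sumDual n) ∘ₗ
        contract (sumDual n ∘ₗ LinearMap.mulLeft ℝ (fun p => ζ p + α / 2)))) k w a z S hS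
    rw [pairing_formPf_contract_contract, ι_mul_ι_mul a z S] at h
    simp only [prodForm_apply, LinearMap.comp_apply, map_neg] at h
    linear_combination -h
  · have h1 : Even (k + 1) := by simp [Nat.even_add_one, hk]
    have h2 : ¬Even (k + 2) := by simp [Nat.even_add_one, hk]
    simp only [charPf_odd hk, charPf_even h1, charPf_odd h2, hD, hΘ, hΘ₀]
    have h := pairing_one_one (prodForm
      (formPf (schurForm α ζ) (schurForm_isAlt α ζ) ∘ₗ contract (sumDual n))
      (formPf (schurForm α ζ) (schurForm_isAlt α ζ) ∘ₗ
        contract (sumDual n ∘ₗ LinearMap.mulLeft ℝ (fun p => ζ p + α / 2)))) k w a z S hS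
    rw [pairing_contract_contract, ι_mul_ι_mul a z S] at h
    simp only [prodForm_apply, LinearMap.comp_apply, map_neg] at h
    linear_combination h

end Identities

section TauFunctions

variable {n : ℕ}

/-- The Pfaffian of the word `l, …, l + k - 1`, preceded by `d₀` if `k` is odd. -/
def momentPf (α : ℝ) (ζ β : Fin n → ℝ) (l : ℤ) (k : ℕ) (t : ℝ) : ℝ :=
  charPf α ζ k (momentWedge ζ β l k t)

/-- The time derivative of `momentPf`. -/
def momentPfDeriv (α : ℝ) (ζ β : Fin n → ℝ) (l : ℤ) (k : ℕ) (t : ℝ) : ℝ :=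
  charPf α ζ k (extDerivation (LinearMap.mulLeft ℝ ζ) (momentWedge ζ β l k t))

variable {α : ℝ} {ζ : Fin n → ℝ} (β : Fin n → ℝ)

theorem hasDerivAt_momentPf (l : ℤ) (k : ℕ) (t : ℝ) :
    HasDerivAt (momentPf α ζ β l k) (momentPfDeriv α ζ β l k t) t :=
  hasDerivAt_momentWedge β (charPf α ζ k) l k t

theorem momentPf_zero (l : ℤ) (t : ℝ) : momentPf α ζ β l 0 t = 1 := by
  rw [momentPf, momentWedge_zero, charPf_even (by simp), formPf_one]

theorem momentPfDeriv_zero (l : ℤ) (t : ℝ) : momentPfDeriv α ζ β l 0 t = 0 := by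
  rw [momentPfDeriv, momentWedge_zero, extDerivation_one, map_zero]

theorem momentPfDeriv_one (hζ : ∀ p, 0 < ζ p) (l : ℤ) (t : ℝ) :
    momentPfDeriv α ζ β l 1 t = momentPf α ζ β (l + 1) 1 t := by
  have h := extDerivation_momentWedge β hζ l 0 t
  rw [zero_add] at h
  rw [momentPfDeriv, h, momentPf, momentWedge_succ β (l + 1) 0]
  simp [momentWedge_zero]

/-- The bilinear equation equivalent to the lattice equation for `s_k`. -/
theorem momentPf_hirota (hζ : ∀ p, 0 < ζ p) (l : ℤ) (k : ℕ) (t : ℝ) :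
    momentPfDeriv α ζ β (l + 1) (k + 1) t * momentPf α ζ β l (k + 2) t -
      momentPf α ζ β (l + 1) (k + 1) t * momentPfDeriv α ζ β l (k + 2) t =
    momentPf α ζ β (l + 1) k t * momentPf α ζ β l (k + 3) t -
      momentPf α ζ β (l + 1) (k + 2) t * momentPf α ζ β l (k + 1) t := by
  have h := charPf_quadratic (α := α) (ζ := ζ) k _ (momentVec ζ β (l + 1 + k) t)
    (momentVec ζ β (l + 1 + k + 1) t) (momentVec ζ β l t) (momentWedge ζ β (l + 1) k t) rfl
  have hs : ((-1 : ℝ) ^ k) * (-1) ^ k = 1 := by rw [← mul_pow]; simp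
  have e1 : momentWedge ζ β (l + 1) (k + 1) t = (-1 : ℝ) ^ k •
      (ExteriorAlgebra.ι ℝ (momentVec ζ β (l + 1 + k) t) * momentWedge ζ β (l + 1) k t) := by
    rw [momentWedge_succ_right, ι_mul_momentWedge]
  have e2 : extDerivation (LinearMap.mulLeft ℝ ζ) (momentWedge ζ β (l + 1) (k + 1) t) =
      (-1 : ℝ) ^ k • (ExteriorAlgebra.ι ℝ (momentVec ζ β (l + 1 + k + 1) t) *
        momentWedge ζ β (l + 1) k t) := by
    rw [extDerivation_momentWedge β hζ, ι_mul_momentWedge]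
  have e3 : momentWedge ζ β (l + 1) (k + 2) t =
      ExteriorAlgebra.ι ℝ (momentVec ζ β (l + 1 + k) t) *
        (ExteriorAlgebra.ι ℝ (momentVec ζ β (l + 1 + k + 1) t) *
          momentWedge ζ β (l + 1) k t) := by
    rw [momentWedge_succ_right, ι_mul_momentWedge, e1, mul_smul_comm, smul_smul, pow_succ,
      mul_neg_one, neg_mul, hs, ι_mul_ι_mul, smul_neg, neg_smul, one_smul, neg_neg,
      show l + 1 + ((k + 1 : ℕ) : ℤ) = l + 1 + k + 1 by push_cast; ring]
  have e4 : momentWedge ζ β l (k + 2) t = (-1 : ℝ) ^ k •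
      (ExteriorAlgebra.ι ℝ (momentVec ζ β l t) *
      (ExteriorAlgebra.ι ℝ (momentVec ζ β (l + 1 + k) t) * momentWedge ζ β (l + 1) k t)) := by
    rw [momentWedge_succ, e1, mul_smul_comm]
  have e5 : extDerivation (LinearMap.mulLeft ℝ ζ) (momentWedge ζ β l (k + 2) t) = (-1 : ℝ) ^ k •
      (ExteriorAlgebra.ι ℝ (momentVec ζ β l t) *
      (ExteriorAlgebra.ι ℝ (momentVec ζ β (l + 1 + k + 1) t) * momentWedge ζ β (l + 1) k t)) := by
    rw [extDerivation_momentWedge β hζ, momentWedge_succ, mul_assoc, ι_mul_momentWedge,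
      mul_smul_comm, show l + ((k + 1 : ℕ) : ℤ) + 1 = l + 1 + k + 1 by push_cast; ring]
  unfold momentPf momentPfDeriv
  rw [e2, e5, momentWedge_succ β l (k + 2), e4, e3, e1, momentWedge_succ β l k]
  simp only [map_smul, smul_eq_mul]
  rw [← h]
  linear_combination (charPf α ζ (k + 1) (ExteriorAlgebra.ι ℝ (momentVec ζ β (l + 1 + k + 1) t) *
      momentWedge ζ β (l + 1) k t) * charPf α ζ (k + 2) (ExteriorAlgebra.ι ℝ (momentVec ζ β l t) *
      (ExteriorAlgebra.ι ℝ (momentVec ζ β (l + 1 + k) t) * momentWedge ζ β (l + 1) k t)) -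
    charPf α ζ (k + 1) (ExteriorAlgebra.ι ℝ (momentVec ζ β (l + 1 + k) t) *
      momentWedge ζ β (l + 1) k t) * charPf α ζ (k + 2) (ExteriorAlgebra.ι ℝ (momentVec ζ β l t) *
      (ExteriorAlgebra.ι ℝ (momentVec ζ β (l + 1 + k + 1) t) *
        momentWedge ζ β (l + 1) k t))) * hs

/-- The bilinear equation equivalent, modulo the previous one, to the lattice equation for
`r_k`. -/
theorem momentPf_toda (hα : 0 ≤ α) (hζ : ∀ p, 0 < ζ p) (l : ℤ) (k : ℕ) (t : ℝ) :
    momentPfDeriv α ζ β l (k + 2) t * momentPf α ζ β (l + 1) k t -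
      momentPf α ζ β l (k + 2) t * momentPfDeriv α ζ β (l + 1) k t +
      α * momentPf α ζ β (l + 1) k t * momentPf α ζ β l (k + 2) t =
    momentPf α ζ β l (k + 1) t * momentPfDeriv α ζ β (l + 1) (k + 1) t -
      momentPfDeriv α ζ β l (k + 1) t * momentPf α ζ β (l + 1) (k + 1) t := by
  have hD : ∀ l k, charPf α ζ k (extDerivation (LinearMap.mulLeft ℝ (fun p => ζ p + α / 2))
      (momentWedge ζ β l k t)) =
      momentPfDeriv α ζ β l k t + k * (α / 2) * momentPf α ζ β l k t := fun l k => by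
    rw [extDerivation_shift_momentWedge, map_add, map_smul, smul_eq_mul]
    rfl
  have h := charPf_quadratic_deriv hα hζ k _ (momentVec ζ β (l + 1 + k) t)
    (momentVec ζ β l t) (momentWedge ζ β (l + 1) k t) rfl _ rfl
  have hs : ((-1 : ℝ) ^ k) * (-1) ^ k = 1 := by rw [← mul_pow]; simp
  have e1 : ExteriorAlgebra.ι ℝ (momentVec ζ β (l + 1 + k) t) * momentWedge ζ β (l + 1) k t =
      (-1 : ℝ) ^ k • momentWedge ζ β (l + 1) (k + 1) t := by
    rw [momentWedge_succ_right, ι_mul_momentWedge, smul_smul, hs, one_smul]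
  rw [e1, mul_smul_comm, ← momentWedge_succ β l (k + 1), ← momentWedge_succ β l k] at h
  simp only [map_smul, hD, smul_eq_mul] at h
  simp only [← momentPf.eq_1 α ζ β] at h
  have hsne : ((-1 : ℝ) ^ k) ≠ 0 := by
    intro h0
    rw [h0] at hs
    simp at hs
  refine mul_left_cancel₀ hsne ?_
  push_cast at h
  linear_combination h

end TauFunctions

/-! ### Schur's Pfaffian and the sum formula -/

section SchurPfaffian

open Polynomial in
/-- Lagrange interpolation of `∏ (X - y_b) - ∏ (X + y_b)` at the points `-y_j`. -/
theorem prod_sub_sub_prod_add_eq_sum {m : ℕ} (y : Fin (m + 1) → ℝ) (hy : Function.Injective y)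
    (z : ℝ) :
    ∏ b, (z - y b) - ∏ b, (z + y b) =
      ∑ j, ((-1) ^ (m + 1) * (2 * y j) *
        ∏ i, ((y (j.succAbove i) + y j) / (y (j.succAbove i) - y j))) *
        ∏ i, (z + y (j.succAbove i)) := by
  have hsep : ∀ j i, y (j.succAbove i) - y j ≠ 0 := fun j i =>
    sub_ne_zero.mpr (hy.ne (Fin.succAbove_ne j i))
  have h1 : (∏ b, (X - C (y b)) : ℝ[X]).Monic := monic_prod_of_monic _ _ fun b _ => monic_X_sub_C _
  have h2 : (∏ b, (X + C (y b)) : ℝ[X]).Monic := monic_prod_of_monic _ _ fun b _ => monic_X_add_C _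
  have d1 : (∏ b, (X - C (y b)) : ℝ[X]).degree = (m + 1 : ℕ) := by
    rw [degree_prod]; simp
  have d2 : (∏ b, (X + C (y b)) : ℝ[X]).degree = (m + 1 : ℕ) := by
    rw [degree_prod]; simp
  let P : ℝ[X] := ∏ b, (X - C (y b)) - ∏ b, (X + C (y b))
  let Q : ℝ[X] := ∑ j, C ((-1) ^ (m + 1) * (2 * y j) *
        ∏ i, ((y (j.succAbove i) + y j) / (y (j.succAbove i) - y j))) *
        ∏ i, (X + C (y (j.succAbove i)))
  have hP : P.degree < (Finset.univ : Finset (Fin (m + 1))).card := by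
    rw [Finset.card_univ, Fintype.card_fin, ← d1]
    exact degree_sub_lt_left (d1.trans d2.symm) h1.ne_zero (h1.leadingCoeff.trans
      h2.leadingCoeff.symm)
  have hQ : Q.degree < (Finset.univ : Finset (Fin (m + 1))).card := by
    rw [Finset.card_univ, Fintype.card_fin]
    refine (degree_sum_le _ _).trans_lt ((Finset.sup_lt_iff (WithBot.bot_lt_coe _)).mpr
      fun j _ => ?_)
    rw [C_mul']
    refine (degree_smul_le _ _).trans_lt ?_
    rw [degree_prod]
    simp only [degree_X_add_C, Finset.sum_const, Finset.card_univ, Fintype.card_fin]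
    rw [nsmul_eq_mul, mul_one]
    exact_mod_cast Nat.lt_succ_self m
  have hPQ : P = Q := by
    refine eq_of_degrees_lt_of_eval_index_eq (v := fun j => -y j) Finset.univ
      (fun a _ b _ h => hy (neg_injective h)) hP hQ fun k _ => ?_
    simp only [P, Q, eval_sub, eval_prod, eval_X, eval_C, eval_add, eval_finsetSum, eval_mul]
    rw [Finset.sum_eq_single k]
    · rw [Finset.prod_eq_zero (f := fun b => -y k + y b) (Finset.mem_univ k) (by ring), sub_zero,
        Fin.prod_univ_succAbove _ k, mul_assoc, ← Finset.prod_mul_distrib]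
      have : ∀ i, -y k - y (k.succAbove i) = (-1) * ((y (k.succAbove i) + y k) /
          (y (k.succAbove i) - y k) * (-y k + y (k.succAbove i))) := fun i => by
        have := hsep k i
        field_simp
        ring
      simp only [this]
      rw [Finset.prod_mul_distrib, Finset.prod_const, Finset.card_univ, Fintype.card_fin, pow_succ]
      ring
    · intro j _ hj
      obtain ⟨i, hi⟩ := Fin.exists_succAbove_eq hj.symm
      rw [Finset.prod_eq_zero (f := fun i => -y k + y (j.succAbove i)) (Finset.mem_univ i)
        (by rw [hi]; ring), mul_zero]
    · simp
  have := congrArg (eval z) hPQ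
  simpa only [P, Q, eval_sub, eval_prod, eval_X, eval_C, eval_add, eval_finsetSum,
    eval_mul] using this

/-- The partial fraction identity behind Schur's Pfaffian. -/
theorem sum_mul_prod_eq_prod (N : ℕ) (y : Fin (2 * N + 1) → ℝ) (hy : Function.Injective y)
    (hpos : ∀ j, 0 < y j) (z : ℝ) (hz : 0 ≤ z) :
    ∑ j, (y j - z) / (z + y j) *
        ∏ i, ((y (j.succAbove i) + y j) / (y (j.succAbove i) - y j)) =
      ∏ b, ((y b - z) / (z + y b)) := by
  set c : Fin (2 * N + 1) → ℝ := fun j =>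
    ∏ i, ((y (j.succAbove i) + y j) / (y (j.succAbove i) - y j)) with hc
  have hpow : (-1 : ℝ) ^ (2 * N + 1) = -1 := by rw [pow_succ, pow_mul]; simp
  have key : ∀ z : ℝ, 0 ≤ z → ∏ b, ((y b - z) / (z + y b)) =
      -1 + ∑ j, 2 * y j * c j / (z + y j) := fun z hz => by
    have hne : ∀ b, z + y b ≠ 0 := fun b => by linarith [hpos b]
    have hD : ∏ b, (z + y b) ≠ 0 := Finset.prod_ne_zero_iff.mpr fun b _ => hne b
    have h := prod_sub_sub_prod_add_eq_sum y hy z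
    rw [hpow] at h
    have h1 : ∏ b, (y b - z) = -∏ b, (z - y b) := by
      have h' : ∏ b, (y b - z) = ∏ b, (-1) * (z - y b) :=
        Finset.prod_congr rfl fun b _ => by ring
      rw [h', Finset.prod_mul_distrib, Finset.prod_const, Finset.card_univ, Fintype.card_fin, hpow,
        neg_one_mul]
    rw [Finset.prod_div_distrib, div_eq_iff hD, h1, add_mul, Finset.sum_mul]
    have h2 : ∀ j, 2 * y j * c j / (z + y j) * ∏ b, (z + y b) =
        2 * y j * c j * ∏ i, (z + y (j.succAbove i)) := fun j => by
      rw [Fin.prod_univ_succAbove _ j]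
      have := hne j
      field_simp
    have h3 : ∑ j, (-1 * (2 * y j) * c j) * ∏ i, (z + y (j.succAbove i)) =
        -∑ j, 2 * y j * c j * ∏ i, (z + y (j.succAbove i)) := by
      rw [← Finset.sum_neg_distrib]
      exact Finset.sum_congr rfl fun j _ => by ring
    rw [h3] at h
    rw [Finset.sum_congr rfl fun j _ => h2 j]
    linarith
  have h0 : ∑ j, c j = 1 := by
    have h := key 0 le_rfl
    have h1 : ∏ b, ((y b - 0) / (0 + y b)) = 1 := Finset.prod_eq_one fun b _ => by
      have := (hpos b).ne'
      simp [this]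
    have h2 : ∑ j, 2 * y j * c j / (0 + y j) = 2 * ∑ j, c j := by
      rw [Finset.mul_sum]
      refine Finset.sum_congr rfl fun j _ => ?_
      have := (hpos j).ne'
      rw [zero_add]
      field_simp
    rw [h1, h2] at h
    linarith
  have h1 : ∑ j, (y j - z) / (z + y j) * c j =
      ∑ j, 2 * y j * c j / (z + y j) - ∑ j, c j := by
    rw [← Finset.sum_sub_distrib]
    refine Finset.sum_congr rfl fun j _ => ?_
    have : z + y j ≠ 0 := by linarith [hpos j]
    field_simp
    ring
  rw [h1, key z hz, h0]
  ring

/-- The product `∏_{a < b} (x_b - x_a) / (x_a + x_b)`. -/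
def schurProd {k : ℕ} (x : Fin k → ℝ) : ℝ :=
  ∏ a, ∏ b ∈ Finset.Ioi a, ((x b - x a) / (x a + x b))

theorem schurProd_succ {k : ℕ} (x : Fin (k + 1) → ℝ) :
    schurProd x = (∏ b : Fin k, ((x b.succ - x 0) / (x 0 + x b.succ))) *
      schurProd (fun b : Fin k => x b.succ) := by
  simp only [schurProd, Fin.prod_univ_succ, Fin.prod_Ioi_zero, Fin.prod_Ioi_succ]

theorem schurProd_comp_perm {k : ℕ} (σ : Equiv.Perm (Fin k)) (x : Fin k → ℝ) :
    schurProd (x ∘ σ) = ((Equiv.Perm.sign σ : ℤ) : ℝ) * schurProd x := by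
  refine Equiv.Perm.prod_Ioi_comp_eq_sign_mul_prod σ
    (f := fun a b => (x b - x a) / (x a + x b)) fun a b => ?_
  rw [add_comm (x b), ← neg_div, neg_sub]

theorem schurProd_succAbove {k : ℕ} (y : Fin (k + 1) → ℝ) (hy : Function.Injective y)
    (hpos : ∀ j, 0 < y j) (j : Fin (k + 1)) :
    (-1 : ℝ) ^ (j : ℕ) * schurProd (fun i => y (j.succAbove i)) =
      (∏ i, ((y (j.succAbove i) + y j) / (y (j.succAbove i) - y j))) * schurProd y := by
  have h := schurProd_comp_perm j.cycleRange.symm y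
  rw [schurProd_succ] at h
  simp only [Function.comp_apply, Fin.cycleRange_symm_zero, Fin.cycleRange_symm_succ,
    Equiv.Perm.sign_symm, Fin.sign_cycleRange] at h
  push_cast at h
  have hs : ((-1 : ℝ) ^ (j : ℕ)) * (-1) ^ (j : ℕ) = 1 := by rw [← mul_pow]; simp
  have h1 : (∏ i, ((y (j.succAbove i) + y j) / (y (j.succAbove i) - y j))) *
      ∏ i, ((y (j.succAbove i) - y j) / (y j + y (j.succAbove i))) = 1 := by
    rw [← Finset.prod_mul_distrib]
    refine Finset.prod_eq_one fun i _ => ?_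
    have h1 : y (j.succAbove i) - y j ≠ 0 := sub_ne_zero.mpr (hy.ne (Fin.succAbove_ne j i))
    have h2 : y j + y (j.succAbove i) ≠ 0 := by linarith [hpos j, hpos (j.succAbove i)]
    rw [add_comm (y (j.succAbove i))]
    field_simp
  linear_combination (-1 : ℝ) ^ (j : ℕ) * (-schurProd (fun i => y (j.succAbove i))) * h1 +
    (-1 : ℝ) ^ (j : ℕ) * (∏ i, ((y (j.succAbove i) + y j) / (y (j.succAbove i) - y j))) * h +
    (∏ i, ((y (j.succAbove i) + y j) / (y (j.succAbove i) - y j))) * schurProd y * hs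

variable {V : Type*} [AddCommGroup V] [Module ℝ V] (A : LinearMap.BilinForm ℝ V) (hA : A.IsAlt)

/-- Schur's Pfaffian. -/
theorem formPf_eq_schurProd (N : ℕ) (v : Fin (2 * N) → V) (x : Fin (2 * N) → ℝ)
    (hx : Function.Injective x) (hpos : ∀ a, 0 < x a)
    (hv : ∀ a b, A (v a) (v b) = (x b - x a) / (x a + x b)) :
    formPf A hA (ExteriorAlgebra.ιMulti ℝ (2 * N) v) = schurProd x := by
  induction N with
  | zero =>
    have h : ExteriorAlgebra.ιMulti ℝ (2 * 0) v = 1 := ExteriorAlgebra.ιMulti_zero_apply v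
    rw [h, formPf_one]
    simp [schurProd]
  | succ N ih =>
    change Fin (2 * N + 2) → V at v
    change Fin (2 * N + 2) → ℝ at x
    have hy : Function.Injective (fun b : Fin (2 * N + 1) => x b.succ) :=
      hx.comp (Fin.succ_injective _)
    refine (formPf_ιMulti_succ A hA (2 * N) v).trans (Eq.trans ?_ (schurProd_succ x).symm)
    rw [← sum_mul_prod_eq_prod N (fun b => x b.succ) hy (fun b => hpos _) (x 0) (hpos 0).le,
      Finset.sum_mul]
    refine Finset.sum_congr rfl fun j _ => ?_
    rw [ih (fun i => v (j.succAbove i).succ) (fun i => x (j.succAbove i).succ)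
      (hy.comp Fin.succAbove_right_injective) (fun a => hpos _) (fun a b => hv _ _), hv]
    have h := schurProd_succAbove (fun b => x b.succ) hy (fun b => hpos _) j
    linear_combination (x j.succ - x 0) / (x 0 + x j.succ) * h

/-- Schur's Pfaffian of odd order: the character `d` plays the part of an additional node `0`. -/
theorem formPf_contract_eq_schurProd (N : ℕ) (v : Fin (2 * N + 1) → V) (x : Fin (2 * N + 1) → ℝ)
    (hx : Function.Injective x) (hpos : ∀ a, 0 < x a)
    (hv : ∀ a b, A (v a) (v b) = (x b - x a) / (x a + x b)) (d : Module.Dual ℝ V)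
    (hd : ∀ a, d (v a) = 1) :
    formPf A hA (contract d (ExteriorAlgebra.ιMulti ℝ (2 * N + 1) v)) = schurProd x := by
  have h := sum_mul_prod_eq_prod N x hx hpos 0 le_rfl
  have h1 : ∀ j, (x j - 0) / (0 + x j) = 1 := fun j => by
    have := (hpos j).ne'
    simp [this]
  simp only [h1, one_mul] at h
  have h2 : schurProd x = (∑ j, ∏ i, ((x (j.succAbove i) + x j) / (x (j.succAbove i) - x j))) *
      schurProd x := by rw [h, Finset.prod_const_one, one_mul]
  rw [contract_ιMulti, map_sum, h2, Finset.sum_mul]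
  refine Finset.sum_congr rfl fun j _ => ?_
  rw [map_smul, hd, mul_one, smul_eq_mul, ← schurProd_succAbove x hx hpos j]
  congr 1
  exact formPf_eq_schurProd A hA N _ (fun i => x (j.succAbove i))
    (hx.comp Fin.succAbove_right_injective) (fun a => hpos _) (fun a b => hv _ _)

end SchurPfaffian

section Expansion

variable {n : ℕ}

/-- The square of the Vandermonde product divided by the product of the sums `α + ζ_a + ζ_b`, for
the nodes selected by `s`. It vanishes if a node is repeated. -/
def nodeWeight (α : ℝ) (ζ : Fin n → ℝ) {k : ℕ} (s : Fin k → Fin n) : ℝ :=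
  ∏ a, ∏ b ∈ Finset.Ioi a, ((ζ (s b) - ζ (s a)) ^ 2 / (α + ζ (s a) + ζ (s b)))

variable {α : ℝ} {ζ : Fin n → ℝ} (β : Fin n → ℝ)

theorem nodeWeight_nonneg (hα : 0 ≤ α) (hζ : ∀ p, 0 < ζ p) {k : ℕ} (s : Fin k → Fin n) :
    0 ≤ nodeWeight α ζ s :=
  Finset.prod_nonneg fun a _ => Finset.prod_nonneg fun b _ =>
    div_nonneg (sq_nonneg _) (by linarith [hζ (s a), hζ (s b)])

theorem nodeWeight_pos (hα : 0 ≤ α) (hζ : ∀ p, 0 < ζ p) (hinj : Function.Injective ζ) {k : ℕ}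
    (s : Fin k → Fin n) (hs : Function.Injective s) : 0 < nodeWeight α ζ s := by
  refine Finset.prod_pos fun a _ => Finset.prod_pos fun b hb => ?_
  have hne : ζ (s b) - ζ (s a) ≠ 0 :=
    sub_ne_zero.mpr ((hinj.comp hs).ne (Finset.mem_Ioi.mp hb).ne')
  have := hζ (s a)
  have := hζ (s b)
  positivity

theorem nodeWeight_eq_zero {k : ℕ} (s : Fin k → Fin n) (hs : ¬Function.Injective s) :
    nodeWeight α ζ s = 0 := by
  rw [Function.not_injective_iff] at hs
  obtain ⟨a, b, hab, hne⟩ := hs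
  wlog hlt : a < b generalizing a b
  · exact this b a hab.symm hne.symm (lt_of_le_of_ne (not_lt.mp hlt) hne.symm)
  refine Finset.prod_eq_zero (Finset.mem_univ a)
    (Finset.prod_eq_zero (Finset.mem_Ioi.mpr hlt) ?_)
  simp [hab]

theorem charPf_single (hα : 0 ≤ α) (hζ : ∀ p, 0 < ζ p) (hinj : Function.Injective ζ) {k : ℕ}
    (s : Fin k → Fin n) (hs : Function.Injective s) :
    charPf α ζ k (ExteriorAlgebra.ιMulti ℝ k fun a => (Pi.single (s a) 1 : Fin n → ℝ)) =
      schurProd (fun a => ζ (s a) + α / 2) := by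
  have hx : Function.Injective (fun a => ζ (s a) + α / 2) := fun a b h =>
    hs (hinj (add_right_cancel h))
  have hpos : ∀ a, 0 < ζ (s a) + α / 2 := fun a => by linarith [hζ (s a)]
  have hv : ∀ a b, schurForm α ζ (Pi.single (s a) 1) (Pi.single (s b) 1) =
      ((ζ (s b) + α / 2) - (ζ (s a) + α / 2)) / ((ζ (s a) + α / 2) + (ζ (s b) + α / 2)) :=
    fun a b => by
      rw [schurForm_single]
      congr 1 <;> ring
  by_cases hk : Even k
  · obtain ⟨N, rfl⟩ := hk.two_dvd
    rw [charPf_even hk]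
    exact formPf_eq_schurProd _ _ N _ _ hx hpos hv
  · obtain ⟨N, rfl⟩ := Nat.not_even_iff_odd.mp hk
    rw [charPf_odd hk]
    exact formPf_contract_eq_schurProd _ _ N _ _ hx hpos hv _ fun a => by simp [sumDual_apply]

/-- The minor summation formula: the value of an alternating form at vectors whose coordinates are
those of a weighted Vandermonde matrix. -/
theorem alternating_apply_eq_sum {k : ℕ} (F : (Fin n → ℝ) [⋀^Fin k]→ₗ[ℝ] ℝ) (c ζ : Fin n → ℝ) :
    (k ! : ℝ) * F (fun a p => ζ p ^ (a : ℕ) * c p) =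
      ∑ s : Fin k → Fin n, (∏ a, c (s a)) * (Matrix.vandermonde (fun a => ζ (s a))).det *
        F (fun a => Pi.single (s a) 1) := by
  have h1 : F (fun a p => ζ p ^ (a : ℕ) * c p) = ∑ s : Fin k → Fin n,
      (∏ a, (ζ (s a) ^ (a : ℕ) * c (s a))) * F (fun a => Pi.single (s a) 1) := by
    have h : (fun (a : Fin k) p => ζ p ^ (a : ℕ) * c p) = fun (a : Fin k) => ∑ p,
        (ζ p ^ (a : ℕ) * c p) • (Pi.single p 1 : Fin n → ℝ) := by
      funext a
      rw [pi_eq_sum_univ' (fun p => ζ p ^ (a : ℕ) * c p)]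
    rw [h]
    have h2 := F.toMultilinearMap.map_sum
      (fun (a : Fin k) p => (ζ p ^ (a : ℕ) * c p) • (Pi.single p 1 : Fin n → ℝ))
    refine h2.trans (Finset.sum_congr rfl fun s _ => ?_)
    exact F.toMultilinearMap.map_smul_univ _ _
  have h2 : ∀ σ : Equiv.Perm (Fin k), F (fun a p => ζ p ^ (a : ℕ) * c p) =
      ∑ s : Fin k → Fin n, ((∏ a, c (s a)) * F (fun a => Pi.single (s a) 1)) *
        (((Equiv.Perm.sign σ : ℤ) : ℝ) * ∏ a, ζ (s (σ a)) ^ (a : ℕ)) := fun σ => by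
    rw [h1, ← Equiv.sum_comp (Equiv.arrowCongr σ.symm (Equiv.refl (Fin n)))]
    refine Finset.sum_congr rfl fun s _ => ?_
    have h3 : F (fun a => Pi.single (s (σ a)) 1) =
        ((Equiv.Perm.sign σ : ℤ) : ℝ) * F (fun a => Pi.single (s a) 1) := by
      have := F.map_perm (fun a => (Pi.single (s a) 1 : Fin n → ℝ)) σ
      refine this.trans ?_
      rw [Units.smul_def, zsmul_eq_mul]
    have h4 : ∏ a, c (s (σ a)) = ∏ a, c (s a) := Equiv.prod_comp σ fun a => c (s a)
    simp only [Equiv.arrowCongr_apply, Equiv.symm_symm, Equiv.coe_refl, Function.comp_apply, id]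
    rw [Finset.prod_mul_distrib, h3, h4]
    ring
  have h3 : (k ! : ℝ) * F (fun a p => ζ p ^ (a : ℕ) * c p) =
      ∑ _σ : Equiv.Perm (Fin k), F (fun a p => ζ p ^ (a : ℕ) * c p) := by
    rw [Finset.sum_const, Finset.card_univ, Fintype.card_perm, Fintype.card_fin, nsmul_eq_mul]
  rw [h3, Finset.sum_congr rfl fun σ _ => h2 σ, Finset.sum_comm]
  refine Finset.sum_congr rfl fun s _ => ?_
  rw [← Finset.mul_sum, Matrix.det_apply]
  simp only [Matrix.vandermonde_apply, Units.smul_def, zsmul_eq_mul]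
  ring

/-- The sum formula for the tau functions; the sum runs over ordered `k`-tuples of nodes, which
accounts for the factor `1 / k !`. -/
theorem momentPf_eq_sum (hα : 0 ≤ α) (hζ : ∀ p, 0 < ζ p) (hinj : Function.Injective ζ) (l : ℤ)
    (k : ℕ) (t : ℝ) :
    momentPf α ζ β l k t = 1 / (k ! : ℝ) * ∑ s : Fin k → Fin n, nodeWeight α ζ s *
      ∏ a, (ζ (s a) ^ l * (β (s a) * Real.exp (ζ (s a) * t))) := by
  have h := alternating_apply_eq_sum ((charPf α ζ k).compAlternatingMap
    (ExteriorAlgebra.ιMulti ℝ k)) (momentVec ζ β l t) ζ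
  have h1 : (fun (a : Fin k) p => ζ p ^ (a : ℕ) * momentVec ζ β l t p) =
      fun (a : Fin k) => momentVec ζ β (l + (a : ℕ)) t := by
    funext a p
    simp only [momentVec, zpow_add₀ (hζ p).ne', zpow_natCast]
    ring
  rw [h1] at h
  have h2 : ((charPf α ζ k).compAlternatingMap (ExteriorAlgebra.ιMulti ℝ k))
      (fun (a : Fin k) => momentVec ζ β (l + (a : ℕ)) t) = momentPf α ζ β l k t := rfl
  have hk : (k ! : ℝ) ≠ 0 := by positivity
  rw [h2] at h
  rw [eq_comm, one_div, inv_mul_eq_iff_eq_mul₀ hk, h]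
  refine Finset.sum_congr rfl fun s _ => ?_
  have h3 : ∏ a, (ζ (s a) ^ l * (β (s a) * Real.exp (ζ (s a) * t))) =
      ∏ a, momentVec ζ β l t (s a) := rfl
  rw [h3, mul_comm, mul_assoc]
  congr 1
  by_cases hs : Function.Injective s
  · have h6 : ((charPf α ζ k).compAlternatingMap (ExteriorAlgebra.ιMulti ℝ k))
        (fun a => (Pi.single (s a) 1 : Fin n → ℝ)) = schurProd (fun a => ζ (s a) + α / 2) :=
      charPf_single hα hζ hinj s hs
    rw [h6, Matrix.det_vandermonde, schurProd, nodeWeight,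
      ← Finset.prod_mul_distrib]
    refine Finset.prod_congr rfl fun a _ => ?_
    rw [← Finset.prod_mul_distrib]
    refine Finset.prod_congr rfl fun b _ => ?_
    have h4 : ζ (s a) + α / 2 + (ζ (s b) + α / 2) = α + ζ (s a) + ζ (s b) := by ring
    rw [h4]
    ring
  · have h5 : (Matrix.vandermonde fun a => ζ (s a)).det = 0 := by
      rw [Function.not_injective_iff] at hs
      obtain ⟨a, b, hab, hne⟩ := hs
      exact Matrix.det_vandermonde_eq_zero_iff.mpr ⟨a, b, by rw [hab], hne⟩
    rw [h5, nodeWeight_eq_zero s hs, zero_mul]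

theorem momentPf_pos (hα : 0 ≤ α) (hζ : ∀ p, 0 < ζ p) (hinj : Function.Injective ζ)
    (hβ : ∀ p, 0 < β p) (l : ℤ) {k : ℕ} (hk : k ≤ n) (t : ℝ) : 0 < momentPf α ζ β l k t := by
  have hb : ∀ s : Fin k → Fin n, 0 < ∏ a, (ζ (s a) ^ l * (β (s a) * Real.exp (ζ (s a) * t))) :=
    fun s => Finset.prod_pos fun a _ => mul_pos (zpow_pos (hζ _) _)
      (mul_pos (hβ _) (Real.exp_pos _))
  rw [momentPf_eq_sum β hα hζ hinj]
  refine mul_pos (by positivity) (Finset.sum_pos' (fun s _ => mul_nonneg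
    (nodeWeight_nonneg hα hζ s) (hb s).le) ⟨Fin.castLE hk, Finset.mem_univ _, mul_pos
    (nodeWeight_pos hα hζ hinj _ (Fin.castLE_injective hk)) (hb _)⟩)

theorem momentPf_eq_zero (hα : 0 ≤ α) (hζ : ∀ p, 0 < ζ p) (hinj : Function.Injective ζ)
    (l : ℤ) {k : ℕ} (hk : n < k) (t : ℝ) : momentPf α ζ β l k t = 0 := by
  rw [momentPf_eq_sum β hα hζ hinj, Finset.sum_eq_zero, mul_zero]
  intro s _
  rw [nodeWeight_eq_zero s fun hs => ?_, zero_mul]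
  have := Fintype.card_le_of_injective s hs
  simp only [Fintype.card_fin] at this
  omega

end Expansion

/-! ### Asymptotics, positivity and the lattice equations -/

section Asymptotics

variable {n : ℕ} {α : ℝ} {ζ : Fin n → ℝ} (β : Fin n → ℝ)

/-- Among all `k`-tuples of distinct nodes, the `k` smallest nodes have the least sum. -/
theorem sum_castLE_le_sum (hζ : StrictMono ζ) {k : ℕ} (hk : k ≤ n) (s : Fin k → Fin n)
    (hs : Function.Injective s) : ∑ a, ζ (Fin.castLE hk a) ≤ ∑ a, ζ (s a) := by
  have hmono : StrictMono (s ∘ Tuple.sort s) :=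
    (Tuple.monotone_sort s).strictMono_of_injective (hs.comp (Tuple.sort s).injective)
  have hle : ∀ m (hm : m < k), m ≤ ((s ∘ Tuple.sort s) ⟨m, hm⟩ : ℕ) := by
    intro m
    induction m with
    | zero => intro _; exact Nat.zero_le _
    | succ m ih =>
      intro hm
      have h1 := ih (by omega)
      have h2 : ((s ∘ Tuple.sort s) ⟨m, by omega⟩ : ℕ) < (s ∘ Tuple.sort s) ⟨m + 1, hm⟩ :=
        hmono (Fin.mk_lt_mk.mpr (Nat.lt_succ_self m))
      omega
  rw [← Equiv.sum_comp (Tuple.sort s) fun a => ζ (s a)]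
  exact Finset.sum_le_sum fun a _ => hζ.monotone (hle a.1 a.2)

/-- As `t → -∞` the term with the `k` smallest nodes dominates. -/
theorem tendsto_momentPf_mul_exp (hα : 0 ≤ α) (hζ : ∀ p, 0 < ζ p) (hmono : StrictMono ζ)
    (hβ : ∀ p, 0 < β p) (l : ℤ) {k : ℕ} (hk : k ≤ n) :
    ∃ c : ℝ, 0 < c ∧ Tendsto (fun t => momentPf α ζ β l k t *
      Real.exp (-(∑ a, ζ (Fin.castLE hk a)) * t)) atBot (𝓝 c) := by
  set p := ∑ a, ζ (Fin.castLE hk a) with hp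
  have hc : ∀ s : Fin k → Fin n, 0 < ∏ a, (ζ (s a) ^ l * β (s a)) := fun s =>
    Finset.prod_pos fun a _ => mul_pos (zpow_pos (hζ _) _) (hβ _)
  have hw : ∀ s : Fin k → Fin n, 0 ≤ nodeWeight α ζ s * ∏ a, (ζ (s a) ^ l * β (s a)) := fun s =>
    mul_nonneg (nodeWeight_nonneg hα hζ s) (hc s).le
  refine ⟨1 / (k ! : ℝ) * ∑ s : Fin k → Fin n, if ∑ a, ζ (s a) = p then
    nodeWeight α ζ s * ∏ a, (ζ (s a) ^ l * β (s a)) else 0, ?_, ?_⟩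
  · refine mul_pos (by positivity) (Finset.sum_pos' (fun s _ => ?_)
      ⟨Fin.castLE hk, Finset.mem_univ _, ?_⟩)
    · split_ifs
      exacts [hw s, le_rfl]
    · rw [if_pos rfl]
      exact mul_pos (nodeWeight_pos hα hζ hmono.injective _ (Fin.castLE_injective hk)) (hc _)
  · have h1 : ∀ t, momentPf α ζ β l k t * Real.exp (-p * t) = 1 / (k ! : ℝ) *
        ∑ s : Fin k → Fin n, nodeWeight α ζ s * (∏ a, (ζ (s a) ^ l * β (s a))) *
          Real.exp ((∑ a, ζ (s a) - p) * t) := fun t => by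
      rw [momentPf_eq_sum β hα hζ hmono.injective, mul_assoc, Finset.sum_mul]
      congr 1
      refine Finset.sum_congr rfl fun s _ => ?_
      have h2 : ∏ a, (ζ (s a) ^ l * (β (s a) * Real.exp (ζ (s a) * t))) =
          (∏ a, (ζ (s a) ^ l * β (s a))) * Real.exp ((∑ a, ζ (s a)) * t) := by
        rw [Finset.sum_mul, Real.exp_sum, ← Finset.prod_mul_distrib]
        exact Finset.prod_congr rfl fun a _ => by ring
      rw [h2, sub_mul, sub_eq_add_neg, Real.exp_add, neg_mul]
      ring
    simp only [h1]
    refine (tendsto_finsetSum _ fun s _ => ?_).const_mul _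
    by_cases hs : Function.Injective s
    · split_ifs with h
      · simp [h]
      · have hlt : 0 < ∑ a, ζ (s a) - p :=
          sub_pos.mpr (lt_of_le_of_ne (sum_castLE_le_sum hmono hk s hs) (Ne.symm h))
        have h3 : Tendsto (fun t => Real.exp ((∑ a, ζ (s a) - p) * t)) atBot (𝓝 0) :=
          Real.tendsto_exp_atBot.comp (tendsto_id.const_mul_atBot hlt)
        simpa using h3.const_mul (nodeWeight α ζ s * ∏ a, (ζ (s a) ^ l * β (s a)))
    · simp [nodeWeight_eq_zero s hs]

/-- The two sides have leading exponents that differ by the gap `ζ_{k+1} - ζ_k` (counted from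
`0`). -/
theorem eventually_atBot_lt (hα : 0 ≤ α) (hζ : ∀ p, 0 < ζ p) (hmono : StrictMono ζ)
    (hβ : ∀ p, 0 < β p) (l l' : ℤ) {k : ℕ} (hk : k + 2 ≤ n) :
    ∀ᶠ t in atBot, momentPf α ζ β l (k + 2) t * momentPf α ζ β l' k t <
      momentPf α ζ β l (k + 1) t * momentPf α ζ β l' (k + 1) t := by
  obtain ⟨c₂, -, h₂⟩ := tendsto_momentPf_mul_exp β hα hζ hmono hβ l hk
  obtain ⟨c₀, -, h₀⟩ := tendsto_momentPf_mul_exp β hα hζ hmono hβ l' (show k ≤ n by omega)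
  obtain ⟨c, hc, h⟩ := tendsto_momentPf_mul_exp β hα hζ hmono hβ l (show k + 1 ≤ n by omega)
  obtain ⟨c', hc', h'⟩ := tendsto_momentPf_mul_exp β hα hζ hmono hβ l' (show k + 1 ≤ n by omega)
  have hgap : 0 < ζ ⟨k + 1, by omega⟩ - ζ ⟨k, by omega⟩ :=
    sub_pos.mpr (hmono (Fin.mk_lt_mk.mpr (Nat.lt_succ_self k)))
  have hexp : Tendsto (fun t => Real.exp ((ζ ⟨k + 1, by omega⟩ - ζ ⟨k, by omega⟩) * t)) atBot
      (𝓝 0) := Real.tendsto_exp_atBot.comp (tendsto_id.const_mul_atBot hgap)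
  have hl := (h₂.mul h₀).mul hexp
  rw [mul_zero] at hl
  have hr := h.mul h'
  filter_upwards [hl.eventually_lt hr (mul_pos hc hc')] with t ht
  have e1 : ∑ a : Fin (k + 1), ζ (Fin.castLE (show k + 1 ≤ n by omega) a) =
      ∑ a : Fin k, ζ (Fin.castLE (show k ≤ n by omega) a) + ζ ⟨k, by omega⟩ := by
    rw [Fin.sum_univ_castSucc]
    rfl
  have e2 : ∑ a : Fin (k + 2), ζ (Fin.castLE hk a) =
      ∑ a : Fin k, ζ (Fin.castLE (show k ≤ n by omega) a) + ζ ⟨k, by omega⟩ +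
        ζ ⟨k + 1, by omega⟩ := by
    rw [Fin.sum_univ_castSucc, Fin.sum_univ_castSucc]
    rfl
  rw [e1, e2] at ht
  set q := ∑ a : Fin k, ζ (Fin.castLE (show k ≤ n by omega) a)
  set y := ζ ⟨k, by omega⟩
  set z := ζ ⟨k + 1, by omega⟩
  have e3 : Real.exp (-(q + y + z) * t) * Real.exp (-q * t) * Real.exp ((z - y) * t) =
      Real.exp (-(q + y) * t) * Real.exp (-(q + y) * t) := by
    rw [← Real.exp_add, ← Real.exp_add, ← Real.exp_add]
    congr 1
    ring
  have e4 : 0 < Real.exp (-(q + y) * t) * Real.exp (-(q + y) * t) :=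
    mul_pos (Real.exp_pos _) (Real.exp_pos _)
  refine lt_of_mul_lt_mul_right ?_ e4.le
  calc _ = momentPf α ζ β l (k + 2) t * Real.exp (-(q + y + z) * t) *
        (momentPf α ζ β l' k t * Real.exp (-q * t)) * Real.exp ((z - y) * t) := by
        rw [← e3]; ring
    _ < _ := ht
    _ = _ := by ring

end Asymptotics

section Positivity

/-- One step down in the descent: with `W_j = T_j g_{j+1} - T_{j+1} g_j`, a zero of `W_{j+1}`
forces a zero of `W_j` as long as the neighbours are nonnegative. -/
theorem eq_zero_of_succ_eq_zero {α T₀ T₁ T₂ T₃ g₀ g₁ g₂ g₃ T₁' T₂' g₁' g₂' : ℝ} (hα : 0 ≤ α)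
    (hT₁ : 0 < T₁) (hT₂ : 0 < T₂) (hg₁ : 0 ≤ g₁)
    (hA₁ : g₁' * T₁ - g₁ * T₁' = g₀ * T₂ - g₂ * T₀)
    (hA₂ : g₂' * T₂ - g₂ * T₂' = g₁ * T₃ - g₃ * T₁)
    (hB : T₂' * g₁ - T₂ * g₁' + α * g₁ * T₂ = T₁ * g₂' - T₁' * g₂)
    (hW₀ : 0 ≤ T₀ * g₁ - T₁ * g₀) (hW₁ : T₁ * g₂ - T₂ * g₁ = 0)
    (hW₂ : 0 ≤ T₂ * g₃ - T₃ * g₂) : T₀ * g₁ - T₁ * g₀ = 0 := by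
  have h1 : T₁ * (g₂ * T₀ - g₀ * T₂) = T₂ * (T₀ * g₁ - T₁ * g₀) := by
    linear_combination T₀ * hW₁
  have h2 : T₂ * (g₃ * T₁ - g₁ * T₃) = T₁ * (T₂ * g₃ - T₃ * g₂) := by
    linear_combination T₃ * hW₁
  have key : T₂ ^ 2 * (g₂ * T₀ - g₀ * T₂) + T₁ ^ 2 * (g₃ * T₁ - g₁ * T₃) +
      α * g₁ * T₁ * T₂ ^ 2 = 0 := by
    linear_combination T₁ * T₂ * hB + T₂ ^ 2 * hA₁ + T₁ ^ 2 * hA₂ + (T₂' * T₁ - T₁' * T₂) * hW₁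
  have h3 : 0 ≤ α * g₁ * T₁ * T₂ ^ 2 := by positivity
  have h4 : T₁ * T₂ * (T₂ ^ 2 * (g₂ * T₀ - g₀ * T₂) + T₁ ^ 2 * (g₃ * T₁ - g₁ * T₃)) =
      T₂ ^ 3 * (T₂ * (T₀ * g₁ - T₁ * g₀)) + T₁ ^ 3 * (T₁ * (T₂ * g₃ - T₃ * g₂)) := by
    linear_combination T₂ ^ 3 * h1 + T₁ ^ 3 * h2
  have h5 : T₂ ^ 3 * (T₂ * (T₀ * g₁ - T₁ * g₀)) + T₁ ^ 3 * (T₁ * (T₂ * g₃ - T₃ * g₂)) ≤ 0 := by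
    rw [← h4]
    exact mul_nonpos_of_nonneg_of_nonpos (mul_pos hT₁ hT₂).le (by linarith)
  have h6 : 0 ≤ T₁ ^ 3 * (T₁ * (T₂ * g₃ - T₃ * g₂)) := by positivity
  have h7 : T₂ ^ 4 * (T₀ * g₁ - T₁ * g₀) ≤ 0 := by nlinarith
  have h8 : T₀ * g₁ - T₁ * g₀ ≤ 0 := nonpos_of_mul_nonpos_right h7 (by positivity)
  exact le_antisymm h8 hW₀

/-- Positivity of `T_k g_{k+1} - T_{k+1} g_k` propagates from `t = -∞` to all times. -/
theorem cross_pos {n : ℕ} {α : ℝ} (hα : 0 ≤ α) {T g T' g' : ℕ → ℝ → ℝ}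
    (hT : ∀ k t, HasDerivAt (T k) (T' k t) t) (hg : ∀ k t, HasDerivAt (g k) (g' k t) t)
    (hTpos : ∀ k ≤ n, ∀ t, 0 < T k t) (hTlast : ∀ t, T (n + 1) t = 0)
    (hg_zero : ∀ t, g 0 t = 0) (hgpos : ∀ k ≤ n, ∀ t, 0 < g (k + 1) t)
    (hA : ∀ j t, g' (j + 1) t * T (j + 1) t - g (j + 1) t * T' (j + 1) t =
      g j t * T (j + 2) t - g (j + 2) t * T j t)
    (hB : ∀ j t, T' (j + 1) t * g j t - T (j + 1) t * g' j t + α * g j t * T (j + 1) t =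
      T j t * g' (j + 1) t - T' j t * g (j + 1) t)
    (hbot : ∀ k, k < n → ∀ᶠ t in atBot, 0 < T k t * g (k + 1) t - T (k + 1) t * g k t) :
    ∀ k, k < n → ∀ t, 0 < T k t * g (k + 1) t - T (k + 1) t * g k t := by
  set W : ℕ → ℝ → ℝ := fun k t => T k t * g (k + 1) t - T (k + 1) t * g k t with hW
  have hTc : ∀ k, Continuous (T k) := fun k =>
    continuous_iff_continuousAt.mpr fun t => (hT k t).continuousAt
  have hgc : ∀ k, Continuous (g k) := fun k =>
    continuous_iff_continuousAt.mpr fun t => (hg k t).continuousAt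
  have hWc : ∀ k, Continuous (W k) := fun k =>
    ((hTc k).mul (hgc (k + 1))).sub ((hTc (k + 1)).mul (hgc k))
  by_contra hcon
  push Not at hcon
  obtain ⟨k₁, hk₁, t₁, ht₁⟩ := hcon
  let B : Set ℝ := ⋃ k ∈ Finset.range n, {t | W k t ≤ 0}
  have hBmem : ∀ t, t ∈ B ↔ ∃ k < n, W k t ≤ 0 := fun t => by simp [B]
  have hBclosed : IsClosed B :=
    (Finset.range n).finite_toSet.isClosed_biUnion fun k _ => isClosed_le (hWc k) continuous_const
  have hBne : B.Nonempty := ⟨t₁, (hBmem t₁).mpr ⟨k₁, hk₁, ht₁⟩⟩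
  have hBbdd : BddBelow B := by
    have h : ∀ᶠ t in atBot, ∀ k ∈ Finset.range n, 0 < W k t :=
      (Finset.eventually_all _).mpr fun k hk => hbot k (Finset.mem_range.mp hk)
    obtain ⟨m, hm⟩ := eventually_atBot.mp h
    refine ⟨m, fun t ht => ?_⟩
    obtain ⟨k, hk, hle⟩ := (hBmem t).mp ht
    by_contra hlt
    exact absurd (hm t (not_le.mp hlt).le k (Finset.mem_range.mpr hk)) (not_lt.mpr hle)
  -- the first time at which some `W k` fails to be positive
  set t₀ := sInf B
  have ht₀ : t₀ ∈ B := hBclosed.csInf_mem hBne hBbdd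
  have hnonneg : ∀ k < n, 0 ≤ W k t₀ := fun k hk => by
    refine ge_of_tendsto (((hWc k).tendsto t₀).mono_left (nhdsWithin_le_nhds (s := Set.Iio t₀))) ?_
    filter_upwards [self_mem_nhdsWithin] with t ht
    by_contra hneg
    exact absurd (csInf_le hBbdd ((hBmem t).mpr ⟨k, hk, (not_le.mp hneg).le⟩)) (not_le.mpr ht)
  have hne : ∀ k < n, W k t₀ ≠ 0 := by
    intro k
    induction k with
    | zero =>
      intro hn
      have : 0 < W 0 t₀ := by
        simp only [hW, hg_zero, mul_zero, sub_zero]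
        exact mul_pos (hTpos 0 (Nat.zero_le _) _) (hgpos 0 (Nat.zero_le _) _)
      exact this.ne'
    | succ j ih =>
      intro hj h0
      have hW2 : 0 ≤ W (j + 2) t₀ := by
        rcases Nat.lt_or_ge (j + 2) n with h | h
        · exact hnonneg _ h
        · have hn : j + 3 = n + 1 := by omega
          simp only [hW]
          rw [hn, hTlast, zero_mul, sub_zero, ← hn]
          exact (mul_pos (hTpos _ (by omega) _) (hgpos (j + 2) (by omega) _)).le
      exact ih (by omega) (eq_zero_of_succ_eq_zero hα
        (hTpos (j + 1) (by omega) t₀) (hTpos (j + 2) (by omega) t₀)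
        (hgpos j (by omega) t₀).le (hA j t₀) (hA (j + 1) t₀) (hB (j + 1) t₀)
        (hnonneg j (by omega)) h0 hW2)
  obtain ⟨k, hk, hle⟩ := (hBmem t₀).mp ht₀
  exact hne k hk (le_antisymm hle (hnonneg k hk))

end Positivity

section Solution

variable {n : ℕ}

/-- The functions `σ_{k-1}`, with `σ_{-1} = 0`. -/
def prevSigma (α : ℝ) (ζ β : Fin n → ℝ) : ℕ → ℝ → ℝ
  | 0 => fun _ => 0
  | k + 1 => momentPf α ζ β 1 k

/-- The time derivative of `prevSigma`. -/
def prevSigmaDeriv (α : ℝ) (ζ β : Fin n → ℝ) : ℕ → ℝ → ℝ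
  | 0 => fun _ => 0
  | k + 1 => momentPfDeriv α ζ β 1 k

variable {α : ℝ} {ζ : Fin n → ℝ} (β : Fin n → ℝ)

theorem hasDerivAt_prevSigma (k : ℕ) (t : ℝ) :
    HasDerivAt (prevSigma α ζ β k) (prevSigmaDeriv α ζ β k t) t := by
  cases k with
  | zero => exact hasDerivAt_const _ _
  | succ k => exact hasDerivAt_momentPf β 1 k t

theorem prevSigma_hirota (hζ : ∀ p, 0 < ζ p) (j : ℕ) (t : ℝ) :
    prevSigmaDeriv α ζ β (j + 1) t * momentPf α ζ β 0 (j + 1) t -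
      prevSigma α ζ β (j + 1) t * momentPfDeriv α ζ β 0 (j + 1) t =
    prevSigma α ζ β j t * momentPf α ζ β 0 (j + 2) t -
      prevSigma α ζ β (j + 2) t * momentPf α ζ β 0 j t := by
  cases j with
  | zero =>
    have h := momentPfDeriv_one (α := α) β hζ 0 t
    simp only [zero_add] at h
    simp [prevSigma, prevSigmaDeriv, momentPf_zero, momentPfDeriv_zero, h]
  | succ j => simpa [prevSigma, prevSigmaDeriv] using momentPf_hirota (α := α) β hζ 0 j t

theorem prevSigma_toda (hα : 0 ≤ α) (hζ : ∀ p, 0 < ζ p) (j : ℕ) (t : ℝ) :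
    momentPfDeriv α ζ β 0 (j + 1) t * prevSigma α ζ β j t -
      momentPf α ζ β 0 (j + 1) t * prevSigmaDeriv α ζ β j t +
      α * prevSigma α ζ β j t * momentPf α ζ β 0 (j + 1) t =
    momentPf α ζ β 0 j t * prevSigmaDeriv α ζ β (j + 1) t -
      momentPfDeriv α ζ β 0 j t * prevSigma α ζ β (j + 1) t := by
  cases j with
  | zero => simp [prevSigma, prevSigmaDeriv, momentPfDeriv_zero]
  | succ j => simpa [prevSigma, prevSigmaDeriv] using momentPf_toda β hα hζ 0 j t

theorem prevSigma_cross_pos (hα : 0 ≤ α) (hζ : ∀ p, 0 < ζ p) (hmono : StrictMono ζ)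
    (hβ : ∀ p, 0 < β p) (k : ℕ) (hk : k < n) (t : ℝ) :
    0 < momentPf α ζ β 0 k t * prevSigma α ζ β (k + 1) t -
      momentPf α ζ β 0 (k + 1) t * prevSigma α ζ β k t := by
  refine cross_pos hα (hasDerivAt_momentPf β 0) (hasDerivAt_prevSigma β)
    (fun k hk t => momentPf_pos β hα hζ hmono.injective hβ 0 hk t)
    (momentPf_eq_zero β hα hζ hmono.injective 0 (Nat.lt_succ_self n)) (fun t => rfl)
    (fun k hk t => momentPf_pos β hα hζ hmono.injective hβ 1 hk t)
    (prevSigma_hirota β hζ) (prevSigma_toda β hα hζ) (fun k hk => ?_) k hk t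
  cases k with
  | zero => simp [prevSigma, momentPf_zero]
  | succ k =>
    filter_upwards [eventually_atBot_lt β hα hζ hmono hβ 0 1 hk] with t ht
    exact sub_pos.mpr ht

theorem tau_natCast (hα : 0 ≤ α) (hζ : ∀ p, 0 < ζ p) (k : ℕ) :
    tau α ζ β (k : ℤ) = momentPf α ζ β 0 k := by
  funext t
  exact pfSeq_eq_charPf β hα hζ 0 k t

theorem sigma_natCast_sub_one (hα : 0 ≤ α) (hζ : ∀ p, 0 < ζ p) (k : ℕ) :
    sigma α ζ β ((k : ℤ) - 1) = prevSigma α ζ β k := by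
  funext t
  cases k with
  | zero => rfl
  | succ k =>
    rw [Nat.cast_succ, add_sub_cancel_right]
    exact pfSeq_eq_charPf β hα hζ 1 k t

end Solution

end GenBToda

end

theorem mainTheorem10 (n : ℕ) (α : ℝ) (hα : 0 ≤ α) (ζ β : Fin n → ℝ)
    (hζ_pos : ∀ j, 0 < ζ j) (hζ_mono : StrictMono ζ) (hβ_pos : ∀ j, 0 < β j) :
    (∀ k : ℤ, 0 ≤ k → k ≤ n → ∀ t, GenBToda.tau α ζ β k t ≠ 0) ∧
    GenBToda.IsSolution n α
      (fun k t => GenBToda.tau α ζ β k t / GenBToda.tau α ζ β (k - 1) t)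
      (fun k t => GenBToda.sigma α ζ β (k - 1) t / GenBToda.tau α ζ β k t)
      (fun t => GenBToda.sigma α ζ β n t / GenBToda.tau α ζ β n t) := by
  open GenBToda in
  set T := momentPf α ζ β 0
  set T' := momentPfDeriv α ζ β 0
  set g := prevSigma α ζ β
  set g' := prevSigmaDeriv α ζ β
  have hT : ∀ k t, HasDerivAt (T k) (T' k t) t := hasDerivAt_momentPf β 0
  have hg : ∀ k t, HasDerivAt (g k) (g' k t) t := hasDerivAt_prevSigma β
  have hTpos : ∀ k ≤ n, ∀ t, 0 < T k t := fun k hk t =>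
    momentPf_pos β hα hζ_pos hζ_mono.injective hβ_pos 0 hk t
  have hTlast : ∀ t, T (n + 1) t = 0 :=
    momentPf_eq_zero β hα hζ_pos hζ_mono.injective 0 (Nat.lt_succ_self n)
  have hglast : ∀ t, 0 < g (n + 1) t := momentPf_pos β hα hζ_pos hζ_mono.injective hβ_pos 1 le_rfl
  have hA : ∀ j t, g' (j + 1) t * T (j + 1) t - g (j + 1) t * T' (j + 1) t =
      g j t * T (j + 2) t - g (j + 2) t * T j t := prevSigma_hirota β hζ_pos
  have hB : ∀ j t, T' (j + 1) t * g j t - T (j + 1) t * g' j t + α * g j t * T (j + 1) t =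
      T j t * g' (j + 1) t - T' j t * g (j + 1) t := prevSigma_toda β hα hζ_pos
  have hW : ∀ k < n, ∀ t, 0 < T k t * g (k + 1) t - T (k + 1) t * g k t :=
    prevSigma_cross_pos β hα hζ_pos hζ_mono hβ_pos
  have tau0 : ∀ j : ℕ, tau α ζ β (j : ℤ) = T j := tau_natCast β hα hζ_pos
  have tau1 : ∀ j : ℕ, tau α ζ β ((j : ℤ) + 1) = T (j + 1) := fun j => by
    rw [← tau0]; push_cast; rfl
  have tau2 : ∀ j : ℕ, tau α ζ β ((j : ℤ) + 1 + 1) = T (j + 2) := fun j => by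
    rw [← tau0]; push_cast; rw [add_assoc]; rfl
  have sig0 : ∀ j : ℕ, sigma α ζ β ((j : ℤ) - 1) = g j := sigma_natCast_sub_one β hα hζ_pos
  have sig1 : ∀ j : ℕ, sigma α ζ β (j : ℤ) = g (j + 1) := fun j => by
    rw [← sig0]; push_cast; rw [add_sub_cancel_right]
  have sig2 : ∀ j : ℕ, sigma α ζ β ((j : ℤ) + 1) = g (j + 2) := fun j => by
    rw [← sig1]; push_cast; rfl
  have hr : ∀ j < n, ∀ t, HasDerivAt (fun t => T (j + 1) t / T j t)
      ((T' (j + 1) t * T j t - T (j + 1) t * T' j t) / T j t ^ 2) t := fun j hj t =>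
    (hT (j + 1) t).fun_div (hT j t) (hTpos j hj.le t).ne'
  have hs : ∀ j ≤ n, ∀ t, HasDerivAt (fun t => g j t / T j t)
      ((g' j t * T j t - g j t * T' j t) / T j t ^ 2) t := fun j hj t =>
    (hg j t).fun_div (hT j t) (hTpos j hj t).ne'
  have hsub : ∀ j < n, ∀ t, g j t / T j t - g (j + 1) t / T (j + 1) t ≠ 0 := fun j hj t => by
    have h1 := (hTpos j hj.le t).ne'
    have h2 := (hTpos (j + 1) hj t).ne'
    rw [div_sub_div _ _ h1 h2]
    refine div_ne_zero (fun h => (hW j hj t).ne' ?_) (mul_ne_zero h1 h2)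
    linear_combination -h
  have hsucc : ∀ k : ℤ, 1 ≤ k → ∃ j : ℕ, k = (j : ℤ) + 1 := fun k hk =>
    ⟨(k - 1).toNat, by rw [Int.toNat_of_nonneg (by omega)]; ring⟩
  refine ⟨fun k hk0 hkn t => ?_, ?_⟩
  · obtain ⟨m, rfl⟩ := Int.eq_ofNat_of_zero_le hk0
    rw [tau0]
    exact (hTpos m (by omega) t).ne'
  constructor
  · intro k hk hkn t
    obtain ⟨j, rfl⟩ := hsucc k hk
    simp only [add_sub_cancel_right, tau0, tau1]
    exact (hr j (by omega) t).differentiableAt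
  · intro k hk hkn t
    obtain ⟨j, rfl⟩ := Int.eq_ofNat_of_zero_le hk
    simp only [tau0, sig0]
    exact (hs j (by omega) t).differentiableAt
  · intro k hk hkn t
    obtain ⟨j, rfl⟩ := hsucc k hk
    simp only [add_sub_cancel_right, tau0, tau1]
    exact div_ne_zero (hTpos _ (by omega) t).ne' (hTpos _ (by omega) t).ne'
  · intro k hk hkn t
    obtain ⟨j, rfl⟩ := hsucc k hk
    simp only [add_sub_cancel_right, tau0, tau1, sig0, sig1]
    exact hsub j (by omega) t
  · intro k hk hkn t
    obtain ⟨j, rfl⟩ := hsucc k hk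
    simp only [add_sub_cancel_right, tau0, tau1, sig0, sig1]
    have hj : j < n := by omega
    rw [eq_div_iff (hsub j hj t), (hr j hj t).deriv, (hs j hj.le t).deriv, (hs (j + 1) hj t).deriv]
    have h1 := (hTpos j hj.le t).ne'
    have h2 := (hTpos (j + 1) hj t).ne'
    field_simp
    linear_combination (T j t * T (j + 1) t) * hB j t
  · intro k hk hkn t
    obtain ⟨j, rfl⟩ := hsucc k hk
    simp only [add_sub_cancel_right, tau0, tau1, tau2, sig0, sig1, sig2]
    have hj : j + 1 < n := by omega
    have h1 := (hTpos j (by omega) t).ne'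
    have h2 := (hTpos (j + 1) hj.le t).ne'
    have h3 := (hTpos (j + 2) hj t).ne'
    rw [(hs (j + 1) hj.le t).deriv, hA j t]
    field_simp
  · intro hn t
    obtain ⟨j, rfl⟩ : ∃ j, n = j + 1 := ⟨n - 1, by omega⟩
    push_cast
    simp only [add_sub_cancel_right, tau0, tau1, tau2, sig0, sig1, sig2]
    have h1 := (hTpos j (by omega) t).ne'
    have h2 := (hTpos (j + 1) le_rfl t).ne'
    have h3 : T (j + 2) t = 0 := hTlast t
    rw [(hs (j + 1) le_rfl t).deriv, hA j t, h3]
    field_simp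
  · intro t
    have h : sigma α ζ β (0 - 1) t = 0 := rfl
    simp only [h, zero_div]
  · intro t
    simp only [tau1, hTlast, zero_div]
  · intro t
    simp only [tau0, sig1]
    exact div_ne_zero (hglast t).ne' (hTpos n le_rfl t).ne'
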